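/- Let $p$ be a prime, let $G$ be a finite group with a normal subgroup $N$, and let $F$ be a field of characteristic $p$ that is a splitting field for $G$ and for $N$. Write $J=J(F[N])$ for the Jacobson radical of $F[N]$, so that $F[G]J$ is a two-sided ideal of $F[G]$. Let $B=F[G]e$ be a $p$-block of $G$, where $e$ is a primitive idempotent of the centre of $F[G]$. Recall that $B$ covers the block of $N$ with block idempotent $f$ if $ef\neq 0$, and that a block has defect zero if its defect groups are trivial. For an algebra with principal indecomposable modules $P_1,\dots,P_n$ (one from each isomorphism class), the Cartan matrix is $(c_{ij})$, where $c_{ij}$ is the multiplicity of the head of $P_j$ as a composition factor of $P_i$. Then $B$ covers a $p$-block of defect zero of $N$ if and only if the Cartan matrix of $B$ is equal to the Cartan matrix of the image of $B$ in $F[G/N]$ or to the Cartan matrix of the image of $B$ in $F[G]/F[G]J$. This holds for both readings of "equal": equal for suitable orderings of the principal indecomposable modules of the two algebras; or equal when the images of $P_1,\dots,P_n$ form a complete set of representatives of the principal indecomposable modules of the image of $B$ and the image of $P_i$ carries the same index as $P_i$. -/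

import Mathlib

namespace BlockCartan

section Algebras

/-- `F` is a splitting field for the `F`-algebra `A`: the endomorphism ring of every simple
`A`-module consists of the scalars from `F`.  Every simple `A`-module is isomorphic to `A ⧸ M`
for a maximal left ideal `M`. -/
def IsSplittingFieldFor (F A : Type*) [Field F] [Ring A] [Algebra F A] : Prop :=
  ∀ M : Submodule A A, IsCoatom M →
    ∀ f : Module.End A (A ⧸ M), ∃ c : F, ∀ x : A ⧸ M, f x = c • x

/-- `e` is a central idempotent of `R`. -/
def IsCentralIdempotent {R : Type*} [Ring R] (e : R) : Prop :=
  (∀ x : R, e * x = x * e) ∧ e * e = e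

/-- `e` is a block idempotent of `R`, that is, a primitive idempotent of the centre of `R`.
The block (algebra) that belongs to `e` is the two-sided ideal `R e = Ideal.span {e}`. -/
def IsBlockIdempotent {R : Type*} [Ring R] (e : R) : Prop :=
  IsCentralIdempotent e ∧ e ≠ 0 ∧
    ∀ f : R, IsCentralIdempotent f → f * e = f → f = 0 ∨ f = e

/-- `P` is a principal indecomposable (left) `R`-module: an indecomposable direct summand of the
regular left module. -/
def IsPIM {R : Type*} [Ring R] (P : Submodule R R) : Prop :=
  (∃ Q : Submodule R R, IsCompl P Q) ∧ P ≠ ⊥ ∧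
    ∀ U V : Submodule R R, U ⊓ V = ⊥ → U ⊔ V = P → U = ⊥ ∨ V = ⊥

/-- Let `B` be a direct factor `R e` (with `e` a central idempotent) of the ring `R`.  The family
`P` is a complete set of representatives of the isomorphism classes of the principal
indecomposable modules of `R` that belong to `B`; these are the principal indecomposable modules
of the algebra `B`. -/
def IsCompletePIMFamily {R : Type*} [Ring R] (B : Submodule R R) {ι : Type*}
    (P : ι → Submodule R R) : Prop :=
  (∀ i, IsPIM (P i) ∧ P i ≤ B) ∧
  (∀ i j, Nonempty (P i ≃ₗ[R] P j) → i = j) ∧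
  ∀ Q : Submodule R R, IsPIM Q → Q ≤ B → ∃ i, Nonempty (Q ≃ₗ[R] P i)

/-- The head `M / rad M` of a module, where `rad M` is the intersection of the maximal
submodules of `M`. -/
abbrev Head (R M : Type*) [Ring R] [AddCommGroup M] [Module R M] : Type _ :=
  M ⧸ Module.jacobson R M

/-- The number of factors of the composition series `s` of submodules of `M` that are isomorphic
to `S`. -/
noncomputable def factorCount {R M : Type*} [Ring R] [AddCommGroup M] [Module R M]
    (S : Type*) [AddCommGroup S] [Module R S] (s : CompositionSeries (Submodule R M)) : ℕ :=
  Nat.card {i : Fin s.length //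
    Nonempty ((↥(s i.succ) ⧸ (s i.castSucc).submoduleOf (s i.succ)) ≃ₗ[R] S)}

/-- The multiplicity of the simple module `S` as a composition factor of the module `M` of finite
length.  By the Jordan-Hölder theorem the set below has exactly one element. -/
noncomputable def compositionMultiplicity (R M S : Type*) [Ring R] [AddCommGroup M] [Module R M]
    [AddCommGroup S] [Module R S] : ℕ :=
  sInf {k : ℕ | ∃ s : CompositionSeries (Submodule R M),
    s.head = ⊥ ∧ s.last = ⊤ ∧ k = factorCount S s}

/-- The Cartan matrix determined by a complete family of principal indecomposable modules: the
`(i, j)` entry is the multiplicity of the head of `P j` as a composition factor of `P i`. -/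
noncomputable def cartanMatrix {R : Type*} [Ring R] {ι : Type*} (P : ι → Submodule R R) :
    Matrix ι ι ℕ :=
  fun i j => compositionMultiplicity R (P i) (Head R (P j))

/-- The direct factors `B` of `R` and `B'` of `R'` have the same Cartan matrix, for suitable
orderings of their principal indecomposable modules. -/
def SameCartanMatrix {R R' : Type*} [Ring R] [Ring R'] (B : Submodule R R)
    (B' : Submodule R' R') : Prop :=
  ∃ (n : ℕ) (P : Fin n → Submodule R R) (P' : Fin n → Submodule R' R'),
    IsCompletePIMFamily B P ∧ IsCompletePIMFamily B' P' ∧ cartanMatrix P = cartanMatrix P'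

/-- `B` and its image under `π` have the same Cartan matrix, where a principal indecomposable
module `P i` of `B` and its image `π (P i)` carry the same index. -/
def SameCartanMatrixAlong {R R' : Type*} [Ring R] [Ring R'] (π : R →+* R') (B : Ideal R) : Prop :=
  ∃ (n : ℕ) (P : Fin n → Ideal R),
    IsCompletePIMFamily B P ∧ IsCompletePIMFamily (B.map π) (fun i => (P i).map π) ∧
      cartanMatrix P = cartanMatrix (fun i => (P i).map π)

end Algebras

section DefectGroups

variable (F : Type*) [Field F] {H : Type*} [Group H]

/-- The conjugate `x a x⁻¹` of an element `a` of the group algebra by a group element `x`. -/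
noncomputable def conj (x : H) (a : MonoidAlgebra F H) : MonoidAlgebra F H :=
  MonoidAlgebra.of F H x * a * MonoidAlgebra.of F H x⁻¹

/-- `e` lies in the image of the relative trace map `Tr_D^H : (FH)^D → (FH)^H`, which sends `a`
to the sum of the `x a x⁻¹` over a set of representatives `x` of the left cosets of `D`. -/
def IsRelativeTrace (D : Subgroup H) (e : MonoidAlgebra F H) : Prop :=
  ∃ a : MonoidAlgebra F H, (∀ d ∈ D, conj F d a = a) ∧
    e = ∑ᶠ x : H ⧸ D, conj F (Quotient.out x) a

/-- `D` is a defect group of the block of `FH` with block idempotent `e`: a subgroup that is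
minimal subject to `e` being a relative trace from `D`. -/
def IsDefectGroup (e : MonoidAlgebra F H) (D : Subgroup H) : Prop :=
  IsRelativeTrace F D e ∧ ∀ D' : Subgroup H, D' < D → ¬ IsRelativeTrace F D' e

/-- The block of `FH` with block idempotent `e` has defect `d`: its defect groups have order
`p ^ d`. -/
def HasDefect (p : ℕ) (e : MonoidAlgebra F H) (d : ℕ) : Prop :=
  ∃ D : Subgroup H, IsDefectGroup F e D ∧ Nat.card D = p ^ d

end DefectGroups

section NormalSubgroups

variable (F : Type*) [Field F] {G : Type*} [Group G] (N : Subgroup G)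

/-- The inclusion of group algebras `FN → FG`. -/
noncomputable abbrev incl : MonoidAlgebra F N →+* MonoidAlgebra F G :=
  MonoidAlgebra.mapDomainRingHom F N.subtype

/-- The left ideal `FG · J(FN)` of `FG`. -/
noncomputable def radicalIdeal : Ideal (MonoidAlgebra F G) :=
  Ideal.map (incl F N) (Ring.jacobson (MonoidAlgebra F N))

/-- For normal `N`, `J(FN) g = g J(FN)` for all `g` in `G`, so `FG · J(FN)` is two-sided. -/
instance radicalIdeal_isTwoSided [N.Normal] : (radicalIdeal F N).IsTwoSided := by
  have key : ∀ (g : G) (j : MonoidAlgebra F N), j ∈ Ring.jacobson (MonoidAlgebra F N) →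
      incl F N j * MonoidAlgebra.of F G g ∈ radicalIdeal F N := by
    intro g j hj
    let φ : MonoidAlgebra F N ≃+* MonoidAlgebra F N :=
      MonoidAlgebra.mapDomainRingEquiv F (MulAut.conjNormal g⁻¹)
    have hφ : φ j ∈ Ring.jacobson (MonoidAlgebra F N) := by
      have : RingHomSurjective (φ : MonoidAlgebra F N →+* MonoidAlgebra F N) := ⟨φ.surjective⟩
      exact Ring.le_comap_jacobson (φ : MonoidAlgebra F N →+* MonoidAlgebra F N) hj
    have hcomm : ∀ a : MonoidAlgebra F N, incl F N a * MonoidAlgebra.of F G g =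
        MonoidAlgebra.of F G g * incl F N (φ a) := by
      intro a
      induction a using MonoidAlgebra.induction_linear with
      | zero => simp
      | add a b ha hb => simp only [map_add, add_mul, mul_add, ha, hb]
      | single n r =>
        simp [φ, MonoidAlgebra.single_mul_single, mul_assoc]
    rw [hcomm]
    exact Ideal.mul_mem_left _ _ (Ideal.mem_map_of_mem _ hφ)
  refine ⟨fun {a} b ha => ?_⟩
  induction b using MonoidAlgebra.induction_linear with
  | zero => simp
  | add b c hb hc => rw [mul_add]; exact Ideal.add_mem _ hb hc
  | single g r =>
    have hs : (MonoidAlgebra.single g r : MonoidAlgebra F G) =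
        MonoidAlgebra.single 1 r * MonoidAlgebra.of F G g := by
      simp [MonoidAlgebra.single_mul_single]
    have hc : ∀ x : MonoidAlgebra F G,
        x * MonoidAlgebra.single g r = MonoidAlgebra.single 1 r * (x * MonoidAlgebra.of F G g) := by
      intro x
      induction x using MonoidAlgebra.induction_linear with
      | zero => simp
      | add x y hx hy => simp only [mul_add, add_mul, hx, hy]
      | single h s => simp [MonoidAlgebra.single_mul_single, mul_comm]
    rw [hc]
    refine Ideal.mul_mem_left _ _ ?_
    clear hc hs
    refine Submodule.span_induction (p := fun x _ => x * MonoidAlgebra.of F G g ∈ radicalIdeal F N)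
      ?_ ?_ ?_ ?_ ha
    · rintro _ ⟨j, hj, rfl⟩
      exact key g j hj
    · simp
    · intro x y _ _ hx hy
      rw [add_mul]
      exact Ideal.add_mem _ hx hy
    · intro c x _ hx
      rw [smul_eq_mul, mul_assoc]
      exact Ideal.mul_mem_left _ _ hx

/-- The natural map `FG → F[G/N]`. -/
noncomputable abbrev toQuotientGroup [N.Normal] : MonoidAlgebra F G →+* MonoidAlgebra F (G ⧸ N) :=
  MonoidAlgebra.mapDomainRingHom F (QuotientGroup.mk' N)

/-- The natural map `FG → FG / FG J(FN)`. -/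
noncomputable abbrev toRadicalQuotient [N.Normal] :
    MonoidAlgebra F G →+* MonoidAlgebra F G ⧸ radicalIdeal F N :=
  Ideal.Quotient.mk (radicalIdeal F N)

/-- The block of `FG` with block idempotent `e` covers the block of `FN` with block idempotent
`f`. -/
def Covers (e : MonoidAlgebra F G) (f : MonoidAlgebra F N) : Prop :=
  e * incl F N f ≠ 0

end NormalSubgroups

end BlockCartan

/-! Let `J` be the radical of `FN`. Both sides of the equivalence amount to `J e = 0`.

If `J e = 0`, then `FG J` meets `B = FG e` trivially, so `B` maps bijectively to its image in `FG /
FG J` and the Cartan matrices agree index by index (`sameCartanMatrixAlong_of_injOn`). Conversely, a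
row sum of a Cartan matrix is the length of a principal indecomposable module (PIM). Each PIM of the
image of `B` is a quotient of a PIM of `B`, and non-isomorphic ones come from different PIMs. If the
matrices agree, the total lengths agree, so these quotient maps are injective and the kernel of the
ring map annihilates `B` (`SameCartanMatrix.mul_eq_zero`). Both kernels contain `J`.

A block idempotent `f` of `FN` has defect zero exactly when `J f = 0`. One direction is Higman's
averaging argument. The other uses the splitting field: the trace of a primitive idempotent in the
block is a non-zero scalar multiple of `f`.

The two groups are linked by a central idempotent `w` of `FN` that annihilates `J` and is an
identity on products of elements annihilating `J` from both sides. Every automorphism of `FN` fixes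
`w`, so `w` is central in `FG`. By primitivity, `w` fixes or kills each of `e` and `f`, and it fixes
them exactly when `J` annihilates them. Hence, if `e f ≠ 0`, then `J e = 0` and `J f = 0` are
equivalent. -/

namespace BlockCartan

/-! ### Principal indecomposable modules are local and determined by their heads. -/

section PIM

variable {R : Type*} [Ring R]

/-- A left ideal is a direct summand of the regular module if and only if it contains a right
identity for itself. -/
theorem exists_isCompl_iff_exists_right_identity (P : Submodule R R) :
    (∃ Q, IsCompl P Q) ↔ ∃ ε ∈ P, ∀ x ∈ P, x * ε = x := by
  constructor
  · rintro ⟨Q, hPQ⟩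
    obtain ⟨ε, hε, q, hq, h⟩ := Submodule.mem_sup.1
      (hPQ.sup_eq_top ▸ Submodule.mem_top : (1 : R) ∈ P ⊔ Q)
    refine ⟨ε, hε, fun x hx => ?_⟩
    have hxq : x * q = x - x * ε := by rw [eq_sub_iff_add_eq', ← mul_add, h, mul_one]
    have h1 : x * q ∈ P ⊓ Q :=
      ⟨hxq ▸ P.sub_mem hx (P.smul_mem x hε), Q.smul_mem x hq⟩
    rw [hPQ.inf_eq_bot, Submodule.mem_bot, hxq, sub_eq_zero] at h1
    exact h1.symm
  · rintro ⟨ε, hε, h⟩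
    refine ⟨LinearMap.ker (LinearMap.toSpanSingleton R R ε), ?_, ?_⟩
    · rw [Submodule.disjoint_def]
      intro x hx hx'
      rw [← h x hx]
      simpa using hx'
    · rw [codisjoint_iff, eq_top_iff]
      intro x _
      refine Submodule.mem_sup.2 ⟨x * ε, P.smul_mem x hε, x - x * ε, ?_, by abel⟩
      simp [sub_mul, mul_assoc, h ε hε]

/-- A direct summand of the regular module with a property that is inherited by one of the terms
of each sum contains a principal indecomposable module with that property. -/
theorem exists_isPIM_le [IsArtinianRing R] (φ : Submodule R R → Prop) (h0 : ¬ φ ⊥)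
    (hsup : ∀ U V, φ (U ⊔ V) → φ U ∨ φ V) {B : Submodule R R} (hB : ∃ Q, IsCompl B Q)
    (hφ : φ B) : ∃ P, IsPIM P ∧ P ≤ B ∧ φ P := by
  obtain ⟨P, ⟨⟨Q, hQ⟩, hPB, hP⟩, hmin⟩ := WellFounded.has_min (wellFounded_lt (α := Submodule R R))
    {L | (∃ Q, IsCompl L Q) ∧ L ≤ B ∧ φ L} ⟨B, hB, le_rfl, hφ⟩
  -- `U` is again a direct summand, with complement `V ⊔ Q`, so minimality of `P` gives `U = P`.
  have key : ∀ U V : Submodule R R, U ⊓ V = ⊥ → U ⊔ V = P → φ U → V = ⊥ := by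
    intro U V hi hs hU
    have hUP : U ≤ P := hs ▸ le_sup_left
    have hc : IsCompl U (V ⊔ Q) := by
      refine ⟨?_, ?_⟩
      · exact (disjoint_iff.2 hi).disjoint_sup_right_of_disjoint_sup_left (by rw [hs]; exact hQ.1)
      · rw [codisjoint_iff, ← sup_assoc, hs, hQ.sup_eq_top]
    have hUP' : U = P := by
      by_contra hne
      exact hmin U ⟨⟨_, hc⟩, hUP.trans hPB, hU⟩ (lt_of_le_of_ne hUP hne)
    have hVU : V ≤ U := hUP' ▸ hs ▸ le_sup_right
    rwa [inf_eq_right.2 hVU] at hi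
  refine ⟨P, ⟨⟨Q, hQ⟩, fun h => h0 (h ▸ hP), fun U V hi hs => ?_⟩, hPB, hP⟩
  rcases hsup U V (hs ▸ hP) with h | h
  · exact Or.inr (key U V hi hs h)
  · exact Or.inl (key V U (inf_comm U V ▸ hi) (sup_comm U V ▸ hs) h)

variable {P Q : Submodule R R}

theorem IsPIM.projective (hP : IsPIM P) : Module.Projective R P := by
  obtain ⟨ε, hε, h⟩ := (exists_isCompl_iff_exists_right_identity P).1 hP.1
  refine Module.Projective.of_split P.subtype (LinearMap.toSpanSingleton R P ⟨ε, hε⟩) ?_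
  ext x
  simp [h x x.2]

theorem IsPIM.nontrivial (hP : IsPIM P) : Nontrivial P :=
  Submodule.nontrivial_iff_ne_bot.2 hP.2.1

theorem IsPIM.eq_bot_or_eq_bot_of_isCompl (hP : IsPIM P) {U V : Submodule R P}
    (h : IsCompl U V) : U = ⊥ ∨ V = ⊥ := by
  have hinj := Submodule.map_injective_of_injective P.subtype_injective
  have h1 := hP.2.2 (U.map P.subtype) (V.map P.subtype)
    (by rw [← Submodule.map_inf _ P.subtype_injective, h.inf_eq_bot, Submodule.map_bot])
    (by rw [← Submodule.map_sup, h.sup_eq_top, Submodule.map_subtype_top])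
  refine h1.imp (fun h => hinj ?_) (fun h => hinj ?_) <;> simpa using h

variable [IsArtinianRing R]

/-- Projectivity lifts `P → P / M` through `U` to an endomorphism `f` with image in `U` that is the
identity modulo `M`. By Fitting's lemma some power of `f` is surjective or zero, and zero would
force `M = ⊤`. -/
theorem IsPIM.eq_top_of_sup_eq_top (hP : IsPIM P) {U M : Submodule R P} (hM : M ≠ ⊤)
    (h : U ⊔ M = ⊤) : U = ⊤ := by
  have := hP.projective
  have hs : Function.Surjective (M.mkQ ∘ₗ U.subtype) := by
    rw [← LinearMap.range_eq_top, LinearMap.range_comp, Submodule.range_subtype]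
    have h2 := congrArg (Submodule.map M.mkQ) h
    rwa [Submodule.map_sup, Submodule.mkQ_map_self, sup_bot_eq, Submodule.map_top,
      Submodule.range_mkQ] at h2
  obtain ⟨g, hg⟩ := Module.projective_lifting_property (M.mkQ ∘ₗ U.subtype) M.mkQ hs
  set f : Module.End R P := U.subtype ∘ₗ g with hf
  have hfM : M.mkQ ∘ₗ f = M.mkQ := by rw [hf, ← LinearMap.comp_assoc, hg]
  have hfn : ∀ n : ℕ, M.mkQ ∘ₗ (f ^ n) = M.mkQ := by
    intro n
    induction n with
    | zero => rfl
    | succ n ih =>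
      rw [pow_succ, Module.End.mul_eq_comp, ← LinearMap.comp_assoc, ih, hfM]
  -- `1 ≤ n` ensures that the range of `f ^ n` lies in `U`.
  obtain ⟨n, hn⟩ := ((LinearMap.eventually_isCompl_ker_pow_range_pow f).and
    (Filter.eventually_ge_atTop 1)).exists
  rcases hP.eq_bot_or_eq_bot_of_isCompl hn.1 with h1 | h1
  · have h2 := hn.1.sup_eq_top
    rw [h1, bot_sup_eq] at h2
    rw [eq_top_iff, ← h2]
    rintro _ ⟨x, rfl⟩
    obtain ⟨m, rfl⟩ := Nat.exists_eq_add_of_le hn.2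
    rw [pow_add, pow_one, Module.End.mul_apply]
    exact (g _).2
  · exfalso
    apply hM
    rw [LinearMap.range_eq_bot] at h1
    have h2 := hfn n
    rw [h1, LinearMap.comp_zero] at h2
    rw [← Submodule.ker_mkQ M, ← h2, LinearMap.ker_zero]

theorem IsPIM.le_jacobson (hP : IsPIM P) {U : Submodule R P} (hU : U ≠ ⊤) :
    U ≤ Module.jacobson R P := by
  refine le_sInf fun m hm => ?_
  by_contra h
  exact hU (hP.eq_top_of_sup_eq_top hm.1 (by
    rw [sup_comm]
    exact hm.2 _ (lt_of_le_of_ne le_sup_left fun h' => h (h' ▸ le_sup_right))))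

theorem IsPIM.jacobson_ne_top (hP : IsPIM P) : Module.jacobson R P ≠ ⊤ := by
  have := hP.nontrivial
  exact (Module.jacobson_lt_top R P).ne

theorem IsPIM.isCoatom_jacobson (hP : IsPIM P) : IsCoatom (Module.jacobson R P) :=
  ⟨hP.jacobson_ne_top, fun _ hU => by_contra fun h => hU.not_ge (hP.le_jacobson h)⟩

theorem IsPIM.isSimpleModule_head (hP : IsPIM P) : IsSimpleModule R (Head R P) :=
  isSimpleModule_iff_isCoatom.2 hP.isCoatom_jacobson

theorem IsPIM.eq_jacobson_of_isCoatom (hP : IsPIM P) {U : Submodule R P} (hU : IsCoatom U) :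
    U = Module.jacobson R P :=
  le_antisymm (hP.le_jacobson hU.1) (sInf_le hU)

/-- Lift the isomorphism of heads. The image is not inside the radical of `Q`, which contains every
proper submodule. -/
theorem IsPIM.exists_surjective (hP : IsPIM P) (hQ : IsPIM Q)
    (φ : Head R P ≃ₗ[R] Head R Q) : ∃ f : P →ₗ[R] Q, Function.Surjective f := by
  have := hP.projective
  obtain ⟨f, hf⟩ := Module.projective_lifting_property (Module.jacobson R Q).mkQ
    (φ.toLinearMap ∘ₗ (Module.jacobson R P).mkQ) (Submodule.mkQ_surjective _)
  refine ⟨f, LinearMap.range_eq_top.1 (by_contra fun h => ?_)⟩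
  have h1 := hQ.le_jacobson h
  have h2 : (Module.jacobson R Q).mkQ ∘ₗ f = 0 := by
    ext x
    simpa using h1 ⟨x, rfl⟩
  have h3 : Function.Surjective (φ.toLinearMap ∘ₗ (Module.jacobson R P).mkQ) :=
    φ.surjective.comp (Submodule.mkQ_surjective _)
  rw [← hf, h2] at h3
  have := hQ.isSimpleModule_head.nontrivial
  obtain ⟨y, hy⟩ := exists_ne (0 : Head R Q)
  obtain ⟨x, hx⟩ := h3 y
  exact hy (by simpa using hx.symm)

/-- There are surjections both ways, and a surjective endomorphism of a Noetherian module is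
injective. -/
theorem IsPIM.nonempty_equiv_of_head (hP : IsPIM P) (hQ : IsPIM Q)
    (φ : Head R P ≃ₗ[R] Head R Q) : Nonempty (P ≃ₗ[R] Q) := by
  obtain ⟨f, hf⟩ := hP.exists_surjective hQ φ
  obtain ⟨g, hg⟩ := hQ.exists_surjective hP φ.symm
  have h : Function.Injective (g ∘ₗ f) :=
    IsNoetherian.injective_of_surjective_endomorphism _ (hg.comp hf)
  exact ⟨LinearEquiv.ofBijective f ⟨fun x y hxy => h (congrArg g hxy), hf⟩⟩

end PIM

/-! ### Jordan–Hölder multiplicities and length. -/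

section Multiplicity

variable {R M : Type*} [Ring R] [AddCommGroup M] [Module R M]

/-- Having isomorphic factors is an equivalence relation, so only the second isomorphism theorem has
to be checked. -/
theorem nonempty_factor_equiv_of_iso {x y : Submodule R M × Submodule R M}
    (h : JordanHolderLattice.Iso x y) :
    Nonempty ((x.2 ⧸ x.1.submoduleOf x.2) ≃ₗ[R] (y.2 ⧸ y.1.submoduleOf y.2)) := by
  refine JordanHolderLattice.Iso.rel
    (fun x y : Submodule R M × Submodule R M => Nonempty ((x.2 ⧸ x.1.submoduleOf x.2) ≃ₗ[R] (y.2 ⧸ y.1.submoduleOf y.2)))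
    ⟨LinearEquiv.refl _ _⟩ (fun ⟨e⟩ => ⟨e.symm⟩) (fun ⟨e⟩ ⟨e'⟩ => ⟨e.trans e'⟩) ?_ h
  intro x y _
  have e := LinearMap.quotientInfEquivSupQuotient y x
  rw [sup_comm y x] at e
  refine ⟨e.symm.trans (Submodule.quotEquivOfEq _ _ ?_)⟩
  ext z
  simp [Submodule.submoduleOf]

theorem factorCount_congr (S : Type*) [AddCommGroup S] [Module R S]
    {s t : CompositionSeries (Submodule R M)} (h1 : s.head = t.head) (h2 : s.last = t.last) :
    factorCount S s = factorCount S t := by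
  obtain ⟨f, hf⟩ := CompositionSeries.jordan_holder s t h1 h2
  refine Nat.card_congr (f.subtypeEquiv fun i => ?_)
  obtain ⟨e⟩ := nonempty_factor_equiv_of_iso (hf i)
  exact ⟨fun ⟨g⟩ => ⟨e.symm.trans g⟩, fun ⟨g⟩ => ⟨e.trans g⟩⟩

theorem compositionMultiplicity_eq_factorCount (S : Type*) [AddCommGroup S] [Module R S]
    {s : CompositionSeries (Submodule R M)} (h1 : s.head = ⊥) (h2 : s.last = ⊤) :
    compositionMultiplicity R M S = factorCount S s := by
  have : {k : ℕ | ∃ s : CompositionSeries (Submodule R M),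
      s.head = ⊥ ∧ s.last = ⊤ ∧ k = factorCount S s} = {factorCount S s} := by
    ext k
    constructor
    · rintro ⟨t, ht1, ht2, rfl⟩
      exact factorCount_congr S (ht1.trans h1.symm) (ht2.trans h2.symm)
    · rintro rfl
      exact ⟨s, h1, h2, rfl⟩
  rw [compositionMultiplicity, this, csInf_singleton]

theorem exists_compositionSeries_of_finiteLength (R M : Type*) [Ring R] [AddCommGroup M]
    [Module R M] [IsArtinian R M] [IsNoetherian R M] :
    ∃ s : CompositionSeries (Submodule R M), s.head = ⊥ ∧ s.last = ⊤ :=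
  isFiniteLength_iff_exists_compositionSeries.1
    (isFiniteLength_iff_isNoetherian_isArtinian.2 ⟨inferInstance, inferInstance⟩)

/-- A simple quotient of a module is a factor of each composition series of the module. -/
theorem exists_factor_equiv_of_surjective (s : CompositionSeries (Submodule R M))
    (h1 : s.head = ⊥) (h2 : s.last = ⊤) {T : Type*} [AddCommGroup T] [Module R T]
    [IsSimpleModule R T] (f : M →ₗ[R] T) (hf : f ≠ 0) :
    ∃ i : Fin s.length,
      Nonempty ((↥(s i.succ) ⧸ (s i.castSucc).submoduleOf (s i.succ)) ≃ₗ[R] T) := by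
  classical
  have hlast : ¬ s (Fin.last _) ≤ LinearMap.ker f := by
    intro h
    apply hf
    rw [← LinearMap.ker_eq_top, eq_top_iff, ← h2]
    exact h
  have hzero : s 0 ≤ LinearMap.ker f := by
    have : s 0 = ⊥ := h1
    rw [this]
    exact bot_le
  -- At the step where the series leaves the kernel, `f` induces a non-zero map of simple modules.
  obtain ⟨i, hi, hi'⟩ : ∃ i : Fin s.length, s i.castSucc ≤ LinearMap.ker f ∧
      ¬ s i.succ ≤ LinearMap.ker f := by
    by_contra! h
    exact hlast (Fin.induction hzero (fun i hi => h i hi) (Fin.last _))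
  refine ⟨i, ?_⟩
  have hle : (s i.castSucc).submoduleOf (s i.succ) ≤ LinearMap.ker (f ∘ₗ (s i.succ).subtype) :=
    fun x hx => hi hx
  have hcov : s i.castSucc ⋖ s i.succ := s.step i
  have : IsSimpleModule R (↥(s i.succ) ⧸ (s i.castSucc).submoduleOf (s i.succ)) :=
    (covBy_iff_quot_is_simple hcov.1.le).1 hcov
  let g := ((s i.castSucc).submoduleOf (s i.succ)).liftQ (f ∘ₗ (s i.succ).subtype) hle
  have hg : g ≠ 0 := by
    intro h0
    apply hi'
    intro x hx
    exact LinearMap.congr_fun h0 (Submodule.Quotient.mk ⟨x, hx⟩)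
  exact ⟨LinearEquiv.ofBijective g (LinearMap.bijective_of_ne_zero hg)⟩

variable [IsArtinian R M] [IsNoetherian R M] {ι : Type*} [Fintype ι]
  (S : ι → Type*) [∀ j, AddCommGroup (S j)] [∀ j, Module R (S j)]

/-- Each factor of a composition series is counted for at most one `j`. -/
theorem sum_compositionMultiplicity_le_length
    (hS : ∀ i j, Nonempty (S i ≃ₗ[R] S j) → i = j) :
    ((∑ j, compositionMultiplicity R M (S j) : ℕ) : ℕ∞) ≤ Module.length R M := by
  obtain ⟨s, h1, h2⟩ := exists_compositionSeries_of_finiteLength R M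
  simp only [compositionMultiplicity_eq_factorCount _ h1 h2]
  rw [← Module.length_compositionSeries s h1 h2, Nat.cast_le]
  simp only [factorCount]
  rw [← Nat.card_sigma]
  refine (Nat.card_le_card_of_injective (fun x : Σ j, {i : Fin s.length //
    Nonempty ((↥(s i.succ) ⧸ (s i.castSucc).submoduleOf (s i.succ)) ≃ₗ[R] S j)} => x.2.1)
    ?_).trans_eq (Nat.card_fin _)
  rintro ⟨j, i, ⟨e⟩⟩ ⟨j', i', ⟨e'⟩⟩ (rfl : i = i')
  obtain rfl := hS j j' ⟨e.symm.trans e'⟩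
  rfl

/-- Each factor of a composition series is counted for at least one `j`. -/
theorem length_le_sum_compositionMultiplicity
    (hS : ∀ x y : Submodule R M, x ⋖ y → ∃ j, Nonempty ((y ⧸ x.submoduleOf y) ≃ₗ[R] S j)) :
    Module.length R M ≤ ((∑ j, compositionMultiplicity R M (S j) : ℕ) : ℕ∞) := by
  obtain ⟨s, h1, h2⟩ := exists_compositionSeries_of_finiteLength R M
  simp only [compositionMultiplicity_eq_factorCount _ h1 h2]
  rw [← Module.length_compositionSeries s h1 h2, Nat.cast_le]
  simp only [factorCount]
  rw [← Nat.card_sigma]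
  choose j hj using fun i : Fin s.length => hS _ _ (s.step i)
  refine (Nat.card_fin _).symm.trans_le (Nat.card_le_card_of_injective (fun i =>
    (⟨j i, i, hj i⟩ : Σ j, {i : Fin s.length //
    Nonempty ((↥(s i.succ) ⧸ (s i.castSucc).submoduleOf (s i.succ)) ≃ₗ[R] S j)})) ?_)
  intro i i' h
  exact congrArg (fun x => x.2.1) h

end Multiplicity

/-! ### Comparison of modules along a surjective ring homomorphism. -/

section Semilinear

variable {R R' M M' S S' : Type*} [Ring R] [Ring R'] {π : R →+* R'} [RingHomSurjective π]
  [AddCommGroup M] [Module R M] [AddCommGroup M'] [Module R' M']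
  [AddCommGroup S] [Module R S] [AddCommGroup S'] [Module R' S']

/-- Length depends only on the lattice of submodules, and `f` identifies the two lattices because
`π` is surjective. -/
theorem length_eq_of_bijective (f : M →ₛₗ[π] M') (hf : Function.Bijective f) :
    Module.length R M = Module.length R' M' := by
  apply WithBot.coe_injective
  rw [Module.coe_length, Module.coe_length,
    Order.krullDim_eq_of_orderIso (Submodule.orderIsoMapComapOfBijective f hf)]

theorem nonempty_equiv_iff_of_bijective (f : M →ₛₗ[π] M') (hf : Function.Bijective f)
    (g : S →ₛₗ[π] S') (hg : Function.Bijective g) :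
    Nonempty (M ≃ₗ[R] S) ↔ Nonempty (M' ≃ₗ[R'] S') := by
  let F : M ≃+ M' := AddEquiv.ofBijective f hf
  let K : S ≃+ S' := AddEquiv.ofBijective g hg
  have hF : ∀ r x, F (r • x) = π r • F x := fun r x => f.map_smulₛₗ r x
  have hK : ∀ r x, K (r • x) = π r • K x := fun r x => g.map_smulₛₗ r x
  constructor
  · rintro ⟨φ⟩
    refine ⟨((F.symm.trans φ.toAddEquiv).trans K).toLinearEquiv ?_⟩
    intro r x
    obtain ⟨r, rfl⟩ := RingHomSurjective.is_surjective (σ := π) r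
    obtain ⟨x, rfl⟩ := F.surjective x
    simp [← hF, ← hK]
  · rintro ⟨φ⟩
    refine ⟨((F.trans φ.toAddEquiv).trans K.symm).toLinearEquiv ?_⟩
    intro r x
    apply K.injective
    simp [hF, hK]

/-- The map on the factor `y / x` that is induced by a semilinear map. -/
noncomputable def factorMap (f : M →ₛₗ[π] M') (x y : Submodule R M) :
    (y ⧸ x.submoduleOf y) →ₛₗ[π] (y.map f ⧸ (x.map f).submoduleOf (y.map f)) :=
  Submodule.mapQ _ _ ((f.comp y.subtype).codRestrict (y.map f) fun z => ⟨z, z.2, rfl⟩)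
    fun z hz => ⟨z, hz, rfl⟩

theorem factorMap_bijective (f : M →ₛₗ[π] M') (hf : Function.Bijective f) (x y : Submodule R M) :
    Function.Bijective (factorMap f x y) := by
  constructor
  · rw [← LinearMap.ker_eq_bot, LinearMap.ker_eq_bot']
    rintro ⟨z⟩ hz
    refine (Submodule.Quotient.mk_eq_zero _).2 ?_
    obtain ⟨w, hw, h⟩ := (Submodule.Quotient.mk_eq_zero _).1 hz
    have hwz : w = (z : M) := hf.1 h
    exact (hwz ▸ hw : (z : M) ∈ x)
  · rintro ⟨_, z, hz, rfl⟩
    exact ⟨Submodule.Quotient.mk ⟨z, hz⟩, rfl⟩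

theorem compositionMultiplicity_eq_of_bijective [IsArtinian R M] [IsNoetherian R M]
    (f : M →ₛₗ[π] M') (hf : Function.Bijective f) (g : S →ₛₗ[π] S') (hg : Function.Bijective g) :
    compositionMultiplicity R M S = compositionMultiplicity R' M' S' := by
  obtain ⟨s, h1, h2⟩ := exists_compositionSeries_of_finiteLength R M
  let φ := Submodule.orderIsoMapComapOfBijective f hf
  let t : CompositionSeries (Submodule R' M') :=
    s.map ⟨φ, fun {a b} h => (apply_covBy_apply_iff φ).2 h⟩
  have ht : ∀ i, t i = (s i).map f := fun i => rfl
  have ht1 : t.head = ⊥ := by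
    change (s.head).map f = ⊥
    rw [h1, Submodule.map_bot]
  have ht2 : t.last = ⊤ := by
    change (s.last).map f = ⊤
    rw [h2, Submodule.map_top, LinearMap.range_eq_top.2 hf.2]
  rw [compositionMultiplicity_eq_factorCount S h1 h2,
    compositionMultiplicity_eq_factorCount S' ht1 ht2]
  exact Nat.card_congr (Equiv.subtypeEquivRight fun i =>
    nonempty_equiv_iff_of_bijective (factorMap f _ _) (factorMap_bijective f hf _ _) g hg)

/-- The map on heads that is induced by a semilinear map. -/
noncomputable def headMap (f : M →ₛₗ[π] M') : Head R M →ₛₗ[π] Head R' M' :=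
  Submodule.mapQ _ _ f (Module.le_comap_jacobson f)

/-- Since the kernel lies in the radical, the radical of `M` is the full preimage of that of `M'`.
-/
theorem headMap_bijective {f : M →ₛₗ[π] M'} (hf : Function.Surjective f)
    (hk : LinearMap.ker f ≤ Module.jacobson R M) : Function.Bijective (headMap f) := by
  constructor
  · rw [← LinearMap.ker_eq_bot, headMap, Submodule.ker_mapQ,
      Module.comap_jacobson_of_ker_le hf hk, Submodule.mkQ_map_self]
  · rw [← LinearMap.range_eq_top, headMap, Submodule.range_mapQ, LinearMap.range_eq_top.2 hf,
      Submodule.map_top, Submodule.range_mkQ]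

end Semilinear

/-! ### Lengths and Cartan matrices of a block and its image. -/

section Quotient

variable {R R' : Type*} [Ring R] [Ring R']

theorem IsCentralIdempotent.mem_span_iff {e : R} (he : IsCentralIdempotent e) {x : R} :
    x ∈ Ideal.span {e} ↔ x * e = x := by
  rw [Ideal.mem_span_singleton']
  constructor
  · rintro ⟨a, rfl⟩
    rw [mul_assoc, he.2]
  · exact fun h => ⟨x, h⟩

theorem IsCentralIdempotent.exists_isCompl {e : R} (he : IsCentralIdempotent e) :
    ∃ Q, IsCompl (Ideal.span {e} : Ideal R) Q :=
  (exists_isCompl_iff_exists_right_identity _).2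
    ⟨e, Ideal.mem_span_singleton_self e, fun _ hx => he.mem_span_iff.1 hx⟩

theorem mul_eq_self_of_mem_map_span {π : R →+* R'} (hπ : Function.Surjective π) {e : R}
    (he : IsCentralIdempotent e) {y : R'} (hy : y ∈ (Ideal.span {e} : Ideal R).map π) :
    π e * y = y := by
  obtain ⟨x, hx, rfl⟩ := (Ideal.mem_map_iff_of_surjective π hπ).1 hy
  rw [← map_mul, he.1, he.mem_span_iff.1 hx]

/-- The semilinear map from a ring to a module that sends `1` to a given element. -/
noncomputable def semilinearOfElement (π : R →+* R') {M : Type*} [AddCommGroup M] [Module R' M]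
    (y : M) : R →ₛₗ[π] M where
  toFun r := π r • y
  map_add' a b := by rw [map_add, add_smul]
  map_smul' a b := by rw [smul_eq_mul, map_mul, mul_smul]

/-- Isomorphic modules have isomorphic heads. -/
theorem nonempty_head_equiv {M N : Type*} [AddCommGroup M] [Module R M] [AddCommGroup N]
    [Module R N] (φ : M ≃ₗ[R] N) : Nonempty (Head R M ≃ₗ[R] Head R N) :=
  ⟨LinearEquiv.ofBijective (headMap φ.toLinearMap)
    (headMap_bijective φ.surjective (by simp))⟩

theorem IsPIM.ker_le_jacobson [IsArtinianRing R] {π : R →+* R'} {P : Submodule R R}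
    (hP : IsPIM P) {M : Type*} [AddCommGroup M] [Module R' M] [Nontrivial M] (f : P →ₛₗ[π] M)
    (hf : Function.Surjective f) : LinearMap.ker f ≤ Module.jacobson R P := by
  refine hP.le_jacobson fun h => ?_
  obtain ⟨y, hy⟩ := exists_ne (0 : M)
  obtain ⟨x, rfl⟩ := hf y
  exact hy (LinearMap.mem_ker.1 (h ▸ Submodule.mem_top))

variable [IsArtinianRing R]

/-- Since `e • t ≠ 0`, some PIM `L` in `R e` has `L t ≠ 0`. Then `x ↦ x t` maps `L` onto `T`, and
its kernel is the unique maximal submodule of `L`. -/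
theorem exists_isPIM_equiv_head {e : R} (he : IsCentralIdempotent e) {T : Type*} [AddCommGroup T]
    [Module R T] [IsSimpleModule R T] (hT : ∃ t : T, e • t ≠ 0) :
    ∃ L, IsPIM L ∧ L ≤ Ideal.span {e} ∧ Nonempty (T ≃ₗ[R] Head R L) := by
  obtain ⟨t, ht⟩ := hT
  obtain ⟨L, hL, hLB, h⟩ := exists_isPIM_le
    (fun L => ¬ L ≤ LinearMap.ker (LinearMap.toSpanSingleton R T t)) (by simp)
    (fun U V h => by
      by_contra! h'
      exact h (sup_le h'.1 h'.2)) he.exists_isCompl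
    (fun h => ht (h (Ideal.mem_span_singleton_self e)))
  refine ⟨L, hL, hLB, ?_⟩
  set f : L →ₗ[R] T := LinearMap.toSpanSingleton R T t ∘ₗ L.subtype with hf
  have hf0 : f ≠ 0 := fun h0 => h fun x hx => LinearMap.congr_fun h0 ⟨x, hx⟩
  have hs : Function.Surjective f := LinearMap.surjective_of_ne_zero hf0
  have hc : IsCoatom (LinearMap.ker f) :=
    isSimpleModule_iff_isCoatom.1 (IsSimpleModule.congr (f.quotKerEquivOfSurjective hs))
  exact ⟨(f.quotKerEquivOfSurjective hs).symm.trans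
    (Submodule.quotEquivOfEq _ _ (hL.eq_jacobson_of_isCoatom hc))⟩

variable [IsArtinianRing R'] {π : R →+* R'} [RingHomSurjective π] {P : Submodule R R}
  {P₁ P₂ : Submodule R' R'}

/-- For `y` outside the radical of `P₁`, the map `r ↦ π r • y` sends `e` to `y`. Hence it carries
some PIM of `R e` outside the radical, and so onto `P₁`. -/
theorem IsPIM.exists_isPIM_surjective {e : R} (he : IsCentralIdempotent e) (hP : IsPIM P₁)
    (hPB : P₁ ≤ (Ideal.span {e} : Ideal R).map π) :
    ∃ L, IsPIM L ∧ L ≤ Ideal.span {e} ∧ ∃ f : L →ₛₗ[π] P₁, Function.Surjective f := by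
  obtain ⟨y, hy⟩ : ∃ y, y ∉ Module.jacobson R' P₁ := by
    by_contra! h
    exact hP.jacobson_ne_top (eq_top_iff.2 fun y _ => h y)
  obtain ⟨L, hL, hLB, h⟩ := exists_isPIM_le
    (fun L => ¬ L.map (semilinearOfElement π y) ≤ Module.jacobson R' P₁) (by simp)
    (fun U V h => by
      by_contra! h'
      exact h (by rw [Submodule.map_sup]; exact sup_le h'.1 h'.2)) he.exists_isCompl
    (fun h => hy (by
      refine h ⟨e, Ideal.mem_span_singleton_self e, ?_⟩
      ext
      exact mul_eq_self_of_mem_map_span RingHomSurjective.is_surjective he (hPB y.2)))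
  refine ⟨L, hL, hLB, (semilinearOfElement π y).comp L.subtype, ?_⟩
  rw [← LinearMap.range_eq_top, LinearMap.range_comp, Submodule.range_subtype]
  by_contra h'
  exact h (hP.le_jacobson h')

/-- The heads of `P₁` and `P₂` are both identified with the head of `P`. -/
theorem IsPIM.nonempty_equiv_of_surjective (hP : IsPIM P) (h₁ : IsPIM P₁) (h₂ : IsPIM P₂)
    (f₁ : P →ₛₗ[π] P₁) (hf₁ : Function.Surjective f₁) (f₂ : P →ₛₗ[π] P₂)
    (hf₂ : Function.Surjective f₂) : Nonempty (P₁ ≃ₗ[R'] P₂) := by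
  have := h₁.nontrivial
  have := h₂.nontrivial
  obtain ⟨φ⟩ := (nonempty_equiv_iff_of_bijective (headMap f₁)
    (headMap_bijective hf₁ (hP.ker_le_jacobson f₁ hf₁)) (headMap f₂)
    (headMap_bijective hf₂ (hP.ker_le_jacobson f₂ hf₂))).1 ⟨LinearEquiv.refl _ _⟩
  exact h₁.nonempty_equiv_of_head h₂ φ

omit [IsArtinianRing R] [IsArtinianRing R'] in
theorem length_eq_length_ker_add {M M' : Type*} [AddCommGroup M] [Module R M] [AddCommGroup M']
    [Module R' M'] (f : M →ₛₗ[π] M') (hf : Function.Surjective f) :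
    Module.length R M = Module.length R (LinearMap.ker f) + Module.length R' M' := by
  rw [Module.length_eq_add_of_exact (LinearMap.ker f).subtype (LinearMap.ker f).mkQ
    (Submodule.subtype_injective _) (Submodule.mkQ_surjective _)
    (LinearMap.exact_subtype_mkQ _)]
  congr 1
  refine length_eq_of_bijective ((LinearMap.ker f).liftQ f le_rfl) ⟨?_, ?_⟩
  · rw [← LinearMap.ker_eq_bot, Submodule.ker_liftQ_eq_bot' _ _ rfl]
  · rw [← LinearMap.range_eq_top, Submodule.range_liftQ, LinearMap.range_eq_top.2 hf]

/-- `e` acts as the identity on every composition factor of `P i`, so each is the head of some `P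
j`. -/
theorem sum_length_le_sum_cartanMatrix {e : R} (he : IsCentralIdempotent e) {n : ℕ}
    {P : Fin n → Submodule R R} (hP : IsCompletePIMFamily (Ideal.span {e}) P) (i : Fin n) :
    Module.length R (P i) ≤ ((∑ j, cartanMatrix P i j : ℕ) : ℕ∞) := by
  refine length_le_sum_compositionMultiplicity (fun j => Head R (P j)) fun x y hxy => ?_
  have : IsSimpleModule R (y ⧸ x.submoduleOf y) := (covBy_iff_quot_is_simple hxy.1.le).1 hxy
  obtain ⟨t, ht⟩ := @exists_ne _ (IsSimpleModule.nontrivial R (y ⧸ x.submoduleOf y)) 0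
  have het : e • t = t := by
    induction t using Submodule.Quotient.induction_on with
    | _ z =>
      rw [← Submodule.Quotient.mk_smul]
      congr 1
      ext
      change e * ((z : P i) : R) = ((z : P i) : R)
      rw [he.1]
      exact he.mem_span_iff.1 ((hP.1 i).2 (z : P i).2)
  obtain ⟨L, hL, hLB, ⟨φ⟩⟩ := exists_isPIM_equiv_head he ⟨t, het.symm ▸ ht⟩
  obtain ⟨j, ⟨ψ⟩⟩ := hP.2.2 L hL hLB
  obtain ⟨χ⟩ := nonempty_head_equiv ψ
  exact ⟨j, ⟨φ.trans χ⟩⟩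

omit [IsArtinianRing R] in
theorem sum_cartanMatrix_le_length {B : Submodule R' R'} {n : ℕ}
    {P : Fin n → Submodule R' R'} (hP : IsCompletePIMFamily B P) (i : Fin n) :
    ((∑ j, cartanMatrix P i j : ℕ) : ℕ∞) ≤ Module.length R' (P i) := by
  refine sum_compositionMultiplicity_le_length (fun j => Head R' (P j)) ?_
  rintro j k ⟨φ⟩
  exact hP.2.1 j k ((hP.1 j).1.nonempty_equiv_of_head (hP.1 k).1 φ)

/-- If a block and its image in a quotient ring have the same Cartan matrix, then the kernel of
the quotient map annihilates the block. -/
theorem SameCartanMatrix.mul_eq_zero {e : R} (he : IsCentralIdempotent e)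
    (h : SameCartanMatrix (Ideal.span {e} : Ideal R) ((Ideal.span {e} : Ideal R).map π))
    {k : R} (hk : π k = 0) : k * e = 0 := by
  obtain ⟨n, P, P', hP, hP', hc⟩ := h
  have hσ : ∀ i, ∃ j, ∃ f : P j →ₛₗ[π] P' i, Function.Surjective f := by
    intro i
    obtain ⟨L, hL, hLB, f, hf⟩ := (hP'.1 i).1.exists_isPIM_surjective he (hP'.1 i).2
    obtain ⟨j, ⟨ψ⟩⟩ := hP.2.2 L hL hLB
    exact ⟨j, f.comp ψ.symm.toLinearMap, hf.comp ψ.symm.surjective⟩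
  choose σ f hf using hσ
  -- A PIM of `R` has at most one isomorphism class of PIMs of `R'` as images. Both families have
  -- `n` members, so `σ` is a bijection.
  have hinj : Function.Injective σ := by
    intro i j hij
    refine hP'.2.1 i j ?_
    have := hf j
    have key : ∀ k, (hk : σ i = k) → ∀ g : P k →ₛₗ[π] P' j, Function.Surjective g →
        Nonempty (P' i ≃ₗ[R'] P' j) := by
      rintro k rfl g hg
      exact (hP.1 _).1.nonempty_equiv_of_surjective (hP'.1 i).1 (hP'.1 j).1 (f i) (hf i) g hg
    exact key _ hij _ (hf j)
  have hbij : Function.Bijective σ := Finite.injective_iff_bijective.1 hinj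
  have hfin : ∑ i, Module.length R' (P' i) ≠ ⊤ :=
    WithTop.sum_ne_top.2 fun i _ => Module.length_ne_top
  -- `σ` need not be compatible with the indexing in which the matrices agree, so only the totals
  -- over all rows are compared.
  have hsum : ∑ i, Module.length R (LinearMap.ker (f i)) + ∑ i, Module.length R' (P' i) ≤
      ∑ i, Module.length R' (P' i) := by
    rw [← Finset.sum_add_distrib]
    calc ∑ i, (Module.length R (LinearMap.ker (f i)) + Module.length R' (P' i))
        = ∑ i, Module.length R (P (σ i)) :=
          Finset.sum_congr rfl fun i _ => (length_eq_length_ker_add (f i) (hf i)).symm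
      _ = ∑ i, Module.length R (P i) := hbij.sum_comp fun i => Module.length R (P i)
      _ ≤ ∑ i, ((∑ j, cartanMatrix P i j : ℕ) : ℕ∞) :=
          Finset.sum_le_sum fun i _ => sum_length_le_sum_cartanMatrix he hP i
      _ ≤ ∑ i, Module.length R' (P' i) :=
          Finset.sum_le_sum fun i _ => hc ▸ sum_cartanMatrix_le_length hP' i
  have hzero : ∑ i, Module.length R (LinearMap.ker (f i)) = 0 := by
    have := (ENat.add_le_add_iff_right hfin).1 (hsum.trans_eq (zero_add _).symm)
    exact le_antisymm this zero_le
  have hkP : ∀ j, ∀ k, π k = 0 → ∀ x : P j, k • x = 0 := by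
    intro j k hk x
    obtain ⟨i, rfl⟩ := hbij.2 j
    have h1 := (Finset.sum_eq_zero_iff.1 hzero) i (Finset.mem_univ i)
    rw [Module.length_eq_zero_iff] at h1
    have h2 : k • x ∈ LinearMap.ker (f i) := by
      rw [LinearMap.mem_ker, map_smulₛₗ, hk, zero_smul]
    exact congrArg Subtype.val (Subsingleton.elim (⟨k • x, h2⟩ : LinearMap.ker (f i)) 0)
  by_contra hne
  -- If the kernel did not annihilate `R e`, it would act non-trivially on some PIM in `R e`, hence
  -- on some `P j`.
  obtain ⟨L, hL, hLB, k, hk, x, hx, hkx⟩ := exists_isPIM_le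
    (fun L => ∃ k, π k = 0 ∧ ∃ x ∈ L, k * x ≠ 0) (by simp)
    (by
      rintro U V ⟨k, hk, x, hx, hkx⟩
      obtain ⟨u, hu, v, hv, rfl⟩ := Submodule.mem_sup.1 hx
      by_cases hku : k * u = 0
      · exact Or.inr ⟨k, hk, v, hv, fun hkv => hkx (by rw [mul_add, hku, hkv, add_zero])⟩
      · exact Or.inl ⟨k, hk, u, hu, hku⟩) he.exists_isCompl
    ⟨k, hk, e, Ideal.mem_span_singleton_self e, hne⟩
  obtain ⟨j, ⟨ψ⟩⟩ := hP.2.2 L hL hLB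
  have h1 : k • (⟨x, hx⟩ : L) = 0 := ψ.injective (by rw [map_smul, hkP j k hk, map_zero])
  exact hkx (congrArg Subtype.val h1)

end Quotient

/-! ### Finiteness of the set of PIMs, and transport along an injective restriction. -/

section Transport

variable {R R' : Type*} [Ring R] [Ring R']

/-- The principal indecomposable modules in a left ideal of an Artinian ring have a finite
complete family of representatives. -/
theorem exists_isCompletePIMFamily [IsArtinianRing R] (B : Submodule R R) :
    ∃ (n : ℕ) (P : Fin n → Submodule R R), IsCompletePIMFamily B P := by
  let X := {P : Submodule R R // IsPIM P ∧ P ≤ B}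
  let r : Setoid X :=
    { r := fun P Q => Nonempty (P.1 ≃ₗ[R] Q.1)
      iseqv := ⟨fun _ => ⟨LinearEquiv.refl _ _⟩, fun ⟨e⟩ => ⟨e.symm⟩,
        fun ⟨e⟩ ⟨e'⟩ => ⟨e.trans e'⟩⟩ }
  obtain ⟨s, h1, h2⟩ := exists_compositionSeries_of_finiteLength R R
  -- Isomorphism classes of PIMs inject into the factors of one composition series of `R`, because
  -- the head of each PIM is a simple quotient of `R`.
  have hX : ∀ P : X, ∃ i : Fin s.length,
      Nonempty ((↥(s i.succ) ⧸ (s i.castSucc).submoduleOf (s i.succ)) ≃ₗ[R] Head R P.1) := by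
    rintro ⟨P, hP, -⟩
    have := hP.isSimpleModule_head
    obtain ⟨ε, hε, h⟩ := (exists_isCompl_iff_exists_right_identity P).1 hP.1
    refine exists_factor_equiv_of_surjective s h1 h2
      ((Module.jacobson R P).mkQ ∘ₗ LinearMap.toSpanSingleton R P ⟨ε, hε⟩) fun h0 => ?_
    refine hP.jacobson_ne_top (eq_top_iff.2 fun x _ => ?_)
    have h3 : (Module.jacobson R P).mkQ ((x : R) • (⟨ε, hε⟩ : P)) = 0 :=
      LinearMap.congr_fun h0 (x : R)
    rw [Submodule.mkQ_apply, Submodule.Quotient.mk_eq_zero] at h3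
    convert h3
    ext
    exact (h x x.2).symm
  choose c hc using hX
  have hfin : Finite (Quotient r) := by
    refine Finite.of_injective (fun q : Quotient r => c q.out) fun q q' h => ?_
    obtain ⟨φ⟩ := hc q.out
    have hq := hc q'.out
    rw [← show c q.out = c q'.out from h] at hq
    obtain ⟨ψ⟩ := hq
    rw [← q.out_eq, ← q'.out_eq]
    exact Quotient.sound (q.out.2.1.nonempty_equiv_of_head q'.out.2.1 (φ.symm.trans ψ))
  obtain ⟨n, ⟨φ⟩⟩ := Finite.exists_equiv_fin (Quotient r)
  refine ⟨n, fun i => (φ.symm i).out.1, fun i => (φ.symm i).out.2, fun i j h => ?_,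
    fun Q hQ hQB => ⟨φ (Quotient.mk r ⟨Q, hQ, hQB⟩), ?_⟩⟩
  · apply φ.symm.injective
    rw [← (φ.symm i).out_eq, ← (φ.symm j).out_eq]
    exact Quotient.sound h
  · have key : ∀ q : Quotient r, q = Quotient.mk r ⟨Q, hQ, hQB⟩ →
        Nonempty (Q ≃ₗ[R] q.out.1) := by
      rintro q rfl
      exact r.symm (Quotient.mk_out (s := r) ⟨Q, hQ, hQB⟩)
    exact key _ (φ.symm_apply_apply _)

variable {π : R →+* R'} (hπ : Function.Surjective π) {B : Ideal R}
  (hB : ∀ x ∈ B, π x = 0 → x = 0) {L : Ideal R} (hLB : L ≤ B)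

/-- The map from a left ideal to its image. -/
noncomputable def idealMap (π : R →+* R') (L : Ideal R) : L →ₛₗ[π] L.map π where
  toFun x := ⟨π x, Ideal.mem_map_of_mem π x.2⟩
  map_add' x y := by ext; exact map_add π _ _
  map_smul' r x := by ext; exact map_mul π _ _

include hπ hB hLB in
theorem idealMap_bijective : Function.Bijective (idealMap π L) := by
  constructor
  · rw [← LinearMap.ker_eq_bot, LinearMap.ker_eq_bot']
    intro x hx
    ext
    exact hB x (hLB x.2) (congrArg Subtype.val hx)
  · rintro ⟨y, hy⟩
    obtain ⟨x, hx, rfl⟩ := (Ideal.mem_map_iff_of_surjective π hπ).1 hy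
    exact ⟨⟨x, hx⟩, rfl⟩

include hπ hB hLB in
theorem IsPIM.map (hL : IsPIM L) : IsPIM (L.map π) := by
  have hmem : ∀ y, y ∈ L.map π → ∃ x ∈ L, π x = y := fun y hy =>
    (Ideal.mem_map_iff_of_surjective π hπ).1 hy
  refine ⟨?_, fun h => hL.2.1 ?_, fun U V hi hs => ?_⟩
  · obtain ⟨ε, hε, h⟩ := (exists_isCompl_iff_exists_right_identity L).1 hL.1
    refine (exists_isCompl_iff_exists_right_identity _).2 ⟨π ε, Ideal.mem_map_of_mem π hε, ?_⟩
    intro y hy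
    obtain ⟨x, hx, rfl⟩ := hmem y hy
    rw [← map_mul, h x hx]
  · rw [eq_bot_iff]
    intro x hx
    exact hB x (hLB hx) ((Submodule.mem_bot R').1 (h ▸ Ideal.mem_map_of_mem π hx))
  · have hmemU : ∀ y ∈ U, ∃ x ∈ Ideal.comap π U ⊓ L, π x = y := fun y hy => by
      obtain ⟨x, hx, rfl⟩ := hmem y (hs ▸ (le_sup_left : U ≤ U ⊔ V) hy)
      exact ⟨x, ⟨hy, hx⟩, rfl⟩
    have hmemV : ∀ y ∈ V, ∃ x ∈ Ideal.comap π V ⊓ L, π x = y := fun y hy => by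
      obtain ⟨x, hx, rfl⟩ := hmem y (hs ▸ (le_sup_right : V ≤ U ⊔ V) hy)
      exact ⟨x, ⟨hy, hx⟩, rfl⟩
    have h := hL.2.2 (Ideal.comap π U ⊓ L) (Ideal.comap π V ⊓ L) ?_ ?_
    · refine h.imp (fun h => ?_) (fun h => ?_)
      · rw [eq_bot_iff]
        intro y hy
        obtain ⟨x, hx, rfl⟩ := hmemU y hy
        rw [h] at hx
        rw [(Submodule.mem_bot R).1 hx, map_zero]
        exact Submodule.zero_mem _
      · rw [eq_bot_iff]
        intro y hy
        obtain ⟨x, hx, rfl⟩ := hmemV y hy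
        rw [h] at hx
        rw [(Submodule.mem_bot R).1 hx, map_zero]
        exact Submodule.zero_mem _
    · rw [eq_bot_iff]
      rintro x ⟨⟨hxU, hxL⟩, hxV, -⟩
      have : π x ∈ U ⊓ V := ⟨hxU, hxV⟩
      rw [hi] at this
      exact hB x (hLB hxL) this
    · apply le_antisymm (sup_le inf_le_right inf_le_right)
      intro x hx
      obtain ⟨u, hu, v, hv, huv⟩ := Submodule.mem_sup.1
        (hs.symm ▸ Ideal.mem_map_of_mem π hx : π x ∈ U ⊔ V)
      obtain ⟨a, ha, rfl⟩ := hmemU u hu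
      obtain ⟨b, hb, rfl⟩ := hmemV v hv
      refine Submodule.mem_sup.2 ⟨a, ha, b, hb, ?_⟩
      have h0 : x - (a + b) = 0 := hB _
        (hLB (L.sub_mem hx (L.add_mem ha.2 hb.2))) (by rw [map_sub, map_add, huv, sub_self])
      exact (sub_eq_zero.1 h0).symm

include hπ hB in
-- The witness is the preimage of `L'` in `B`. Decompositions of it push forward to decompositions
-- of `L'`, because `π` is injective on `B`.
theorem IsPIM.exists_map_eq {L' : Ideal R'} (hL' : IsPIM L') (hLB' : L' ≤ B.map π) :
    ∃ L : Ideal R, IsPIM L ∧ L ≤ B ∧ L.map π = L' := by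
  have hmem : ∀ y ∈ L', ∃ x ∈ Ideal.comap π L' ⊓ B, π x = y := fun y hy => by
    obtain ⟨x, hx, rfl⟩ := (Ideal.mem_map_iff_of_surjective π hπ).1 (hLB' hy)
    exact ⟨x, ⟨hy, hx⟩, rfl⟩
  have hmap : (Ideal.comap π L' ⊓ B).map π = L' := by
    apply le_antisymm
    · exact Ideal.map_le_iff_le_comap.2 inf_le_left
    · intro y hy
      obtain ⟨x, hx, rfl⟩ := hmem y hy
      exact Ideal.mem_map_of_mem π hx
  refine ⟨Ideal.comap π L' ⊓ B, ⟨?_, fun h => ?_, fun U V hi hs => ?_⟩, inf_le_right, hmap⟩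
  · obtain ⟨ε', hε', h⟩ := (exists_isCompl_iff_exists_right_identity L').1 hL'.1
    obtain ⟨ε, hε, rfl⟩ := hmem ε' hε'
    refine (exists_isCompl_iff_exists_right_identity _).2 ⟨ε, hε, fun x hx => ?_⟩
    exact sub_eq_zero.1 (hB _ (B.sub_mem (B.mul_mem_left x hε.2) hx.2)
      (by rw [map_sub, map_mul, h (π x) hx.1, sub_self]))
  · exact hL'.2.1 (by rw [← hmap, h, Ideal.map_bot])
  · have hUB : U ≤ B := (le_sup_left.trans_eq hs).trans inf_le_right
    have hVB : V ≤ B := (le_sup_right.trans_eq hs).trans inf_le_right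
    have hbot : ∀ W : Ideal R, W ≤ B → W.map π = ⊥ → W = ⊥ := fun W hW h => by
      rw [eq_bot_iff]
      intro x hx
      exact hB x (hW hx) ((Submodule.mem_bot R').1 (h ▸ Ideal.mem_map_of_mem π hx))
    refine (hL'.2.2 (Ideal.map π U) (Ideal.map π V) ?_ ?_).imp (hbot U hUB) (hbot V hVB)
    · rw [eq_bot_iff]
      rintro y ⟨hyU, hyV⟩
      obtain ⟨u, hu, rfl⟩ := (Ideal.mem_map_iff_of_surjective π hπ).1 hyU
      obtain ⟨v, hv, huv⟩ := (Ideal.mem_map_iff_of_surjective π hπ).1 hyV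
      have h0 : v = u := sub_eq_zero.1 (hB _ (B.sub_mem (hVB hv) (hUB hu))
        (by rw [map_sub, huv, sub_self]))
      have : u ∈ U ⊓ V := ⟨hu, h0 ▸ hv⟩
      rw [hi] at this
      rw [(Submodule.mem_bot R).1 this, map_zero]
      exact Submodule.zero_mem _
    · rw [← Ideal.map_sup, hs, hmap]

include hπ hB in
/-- A left ideal on which a surjective ring homomorphism is injective has the same Cartan matrix
as its image. -/
theorem sameCartanMatrixAlong_of_injOn [IsArtinianRing R] : SameCartanMatrixAlong π B := by
  have : RingHomSurjective π := ⟨hπ⟩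
  obtain ⟨n, P, hP⟩ := exists_isCompletePIMFamily (B : Submodule R R)
  have hbij : ∀ L : Ideal R, L ≤ B → Function.Bijective (idealMap π L) :=
    fun L hL => idealMap_bijective hπ hB hL
  refine ⟨n, P, hP, ⟨fun i => ⟨(hP.1 i).1.map hπ hB (hP.1 i).2, Ideal.map_mono (hP.1 i).2⟩,
    fun i j h => ?_, fun Q hQ hQB => ?_⟩, ?_⟩
  · exact hP.2.1 i j ((nonempty_equiv_iff_of_bijective _ (hbij _ (hP.1 i).2) _
      (hbij _ (hP.1 j).2)).2 h)
  · obtain ⟨L, hL, hLB, rfl⟩ := hQ.exists_map_eq hπ hB hQB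
    obtain ⟨i, hi⟩ := hP.2.2 L hL hLB
    exact ⟨i, (nonempty_equiv_iff_of_bijective _ (hbij _ hLB) _ (hbij _ (hP.1 i).2)).1 hi⟩
  · ext i j
    have hj := hbij _ (hP.1 j).2
    exact compositionMultiplicity_eq_of_bijective _ (hbij _ (hP.1 i).2)
      (headMap (idealMap π (P j)))
      (headMap_bijective hj.2 (by rw [LinearMap.ker_eq_bot.2 hj.1]; exact bot_le))

theorem SameCartanMatrixAlong.sameCartanMatrix (h : SameCartanMatrixAlong π B) :
    SameCartanMatrix B (B.map π) := by
  obtain ⟨n, P, hP, hP', hc⟩ := h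
  exact ⟨n, P, _, hP, hP', hc⟩

end Transport

/-! ### Central idempotents annihilating the Jacobson radical. -/

section RadicalAnnihilator

variable {A : Type*} [Ring A]

/-- `y z` squares to zero, so `1 - y z` inverts `1 + y z`. -/
theorem mem_jacobson_of_mul_mul_eq_zero {z : A} (h : ∀ y, z * y * z = 0) :
    z ∈ Ring.jacobson A := by
  rw [← Ideal.jacobson_bot, Ideal.mem_jacobson_iff]
  intro y
  refine ⟨1 - y * z, ?_⟩
  rw [Ideal.mem_bot]
  calc (1 - y * z) * y * z + (1 - y * z) - 1 = - (y * (z * y * z)) := by noncomm_ring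
    _ = 0 := by rw [h, mul_zero, neg_zero]

/-- `1 - v` has a left inverse and annihilates `v`. -/
theorem eq_zero_of_mem_jacobson_of_mul_self {v : A} (h : v ∈ Ring.jacobson A) (hv : v * v = v) :
    v = 0 := by
  rw [← Ideal.jacobson_bot, Ideal.mem_jacobson_iff] at h
  obtain ⟨z, hz⟩ := h (-1)
  rw [Ideal.mem_bot] at hz
  have h1 : (z * -1 * v + z - 1) * v = - v := by
    calc (z * -1 * v + z - 1) * v = - (z * (v * v)) + z * v - v := by noncomm_ring
      _ = - v := by rw [hv]; abel
  rw [hz, zero_mul] at h1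
  exact neg_eq_zero.1 h1.symm

/-- A two-sided ideal `K` that annihilates the Jacobson radical from both sides contains a central
idempotent that is an identity on the products of elements of `K`. -/
theorem exists_isCentralIdempotent_of_mul_jacobson [IsArtinianRing A] (K : Ideal A)
    [K.IsTwoSided] (hl : ∀ j ∈ Ring.jacobson A, ∀ x ∈ K, j * x = 0)
    (hr : ∀ j ∈ Ring.jacobson A, ∀ x ∈ K, x * j = 0) :
    ∃ w ∈ K, IsCentralIdempotent w ∧ ∀ x ∈ K, ∀ y ∈ K, x * y * w = x * y := by
  -- Modulo the radical, `K` has a right identity. Its lift `u` is a right identity up to radical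
  -- elements, and `K J = 0` makes it exact on products. Hence `u * u` is idempotent.
  obtain ⟨ε, hεε, hε⟩ := IsSemisimpleRing.ideal_eq_span_idempotent
    (K.map (Ideal.Quotient.mk (Ring.jacobson A)))
  obtain ⟨u, hu, hue⟩ := (Ideal.mem_map_iff_of_surjective _ Ideal.Quotient.mk_surjective).1
    (hε ▸ Ideal.mem_span_singleton_self ε : ε ∈ K.map (Ideal.Quotient.mk (Ring.jacobson A)))
  have hxu : ∀ x ∈ K, x * u - x ∈ Ring.jacobson A := by
    intro x hx
    obtain ⟨a, ha⟩ := Ideal.mem_span_singleton'.1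
      (hε ▸ Ideal.mem_map_of_mem (Ideal.Quotient.mk (Ring.jacobson A)) hx)
    rw [← Ideal.Quotient.eq_zero_iff_mem, map_sub, map_mul, hue, ← ha, mul_assoc, hεε.eq,
      sub_self]
  have hyxu : ∀ y ∈ K, ∀ x ∈ K, y * x * u = y * x := by
    intro y hy x hx
    rw [← sub_eq_zero, mul_assoc, ← mul_sub]
    exact hr _ (hxu x hx) y hy
  have hw : ∀ x ∈ K, ∀ y ∈ K, x * y * (u * u) = x * y := by
    intro x hx y hy
    rw [← mul_assoc, hyxu x hx y hy, hyxu x hx y hy]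
  have hww : u * u * (u * u) = u * u := hw u hu u hu
  -- The left identity property holds modulo the radical, and `J K = 0` then gives `a u² = u² a u²`.
  -- With `u² a u² = u² a` this makes `u²` central.
  have hz : ∀ p ∈ K, ∀ q ∈ K, (1 - u * u) * (p * q) ∈ Ring.jacobson A := by
    intro p hp q hq
    refine mem_jacobson_of_mul_mul_eq_zero fun y => ?_
    have h0 : p * (q * y) * (1 - u * u) = 0 := by
      rw [mul_sub, mul_one, hw p hp _ (K.mul_mem_right y hq), sub_self]
    calc (1 - u * u) * (p * q) * y * ((1 - u * u) * (p * q))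
        = (1 - u * u) * (p * (q * y) * (1 - u * u)) * (p * q) := by simp only [mul_assoc]
      _ = 0 := by rw [h0, mul_zero, zero_mul]
  refine ⟨u * u, K.mul_mem_left u hu, ⟨fun a => ?_, hww⟩, hw⟩
  have h1 : u * u * a * (u * u) = u * u * a := by
    have := hw u hu (u * a) (K.mul_mem_right a hu)
    rwa [← mul_assoc u u a] at this
  have h2 : (1 - u * u) * (a * u * u) * (u * u) = 0 :=
    hl _ (hz (a * u) (K.mul_mem_left a hu) u hu) _ (K.mul_mem_left u hu)
  rw [mul_assoc, mul_assoc a u u, mul_assoc a, hww, sub_mul, one_mul, sub_eq_zero,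
    ← mul_assoc] at h2
  rw [← mul_assoc, h2, mul_assoc a, ← mul_assoc (u * u), h1]

/-- A property of central idempotents that holds for the identity and is inherited by a summand
holds for some block idempotent. -/
theorem exists_isBlockIdempotent [IsArtinianRing A] (φ : A → Prop) (h0 : ¬ φ 0) (h1 : φ 1)
    (hadd : ∀ f g, φ (f + g) → φ f ∨ φ g) : ∃ f, IsBlockIdempotent f ∧ φ f := by
  obtain ⟨I, ⟨f, hf, rfl, hφ⟩, hmin⟩ := WellFounded.has_min (wellFounded_lt (α := Ideal A))
    {I | ∃ f, IsCentralIdempotent f ∧ Ideal.span {f} = I ∧ φ f}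
    ⟨_, 1, ⟨fun x => by simp, mul_one 1⟩, rfl, h1⟩
  have key : ∀ g, IsCentralIdempotent g → g * f = g → φ g → g = f := by
    intro g hg hgf hφg
    have hle : Ideal.span {g} ≤ Ideal.span {f} := by
      rw [Ideal.span_singleton_le_iff_mem, hf.mem_span_iff]
      exact hgf
    have heq : Ideal.span {g} = Ideal.span {f} := by
      by_contra hne
      exact hmin _ ⟨g, hg, rfl, hφg⟩ (lt_of_le_of_ne hle hne)
    have h2 : f * g = f := hg.mem_span_iff.1 (heq ▸ Ideal.mem_span_singleton_self f)
    rw [← hgf, hg.1, h2]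
  refine ⟨f, ⟨hf, fun h => h0 (h ▸ hφ), fun g hg hgf => ?_⟩, hφ⟩
  have hfg : f * g = g := by rw [hf.1, hgf]
  rcases hadd g (f - g) (by rwa [add_sub_cancel]) with h | h
  · exact Or.inr (key g hg hgf h)
  · left
    have h2 := key (f - g) ⟨fun x => by rw [sub_mul, mul_sub, hf.1, hg.1], by
      rw [sub_mul, mul_sub, mul_sub, hf.2, hg.2, hfg, hgf, sub_self, sub_zero]⟩
      (by rw [sub_mul, hf.2, hgf]) h
    rwa [sub_eq_self] at h2

end RadicalAnnihilator

/-! ### Defect zero and annihilation of the radical. -/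

section GroupAlgebra

variable {F : Type*} [Field F] {H : Type*} [Group H]

theorem isArtinianRing_monoidAlgebra (F H : Type*) [Field F] [Group H] [Finite H] :
    IsArtinianRing (MonoidAlgebra F H) := by
  have : Module.Finite F (MonoidAlgebra F H) := inferInstance
  exact isArtinian_of_tower F (inferInstance : IsArtinian F (MonoidAlgebra F H))

theorem relativeTrace_bot [Fintype H] (a : MonoidAlgebra F H) :
    ∑ᶠ x : H ⧸ (⊥ : Subgroup H), conj F (Quotient.out x) a = ∑ g : H, conj F g a := by
  rw [← finsum_eq_sum_of_fintype]
  refine finsum_eq_of_bijective Quotient.out ⟨Quotient.out_injective, fun g => ?_⟩ fun _ => rfl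
  refine ⟨QuotientGroup.mk g, ?_⟩
  have h := QuotientGroup.out_eq' (QuotientGroup.mk (s := (⊥ : Subgroup H)) g)
  rw [QuotientGroup.eq, Subgroup.mem_bot, inv_mul_eq_one] at h
  exact h

/-- For the trivial subgroup, both minimality and invariance of `a` are automatic. -/
theorem hasDefect_zero_iff (p : ℕ) [Fintype H] (f : MonoidAlgebra F H) :
    HasDefect F p f 0 ↔ ∃ a : MonoidAlgebra F H, f = ∑ g : H, conj F g a := by
  constructor
  · rintro ⟨D, ⟨⟨a, -, ha⟩, -⟩, hD⟩
    rw [pow_zero, Subgroup.card_eq_one] at hD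
    subst hD
    exact ⟨a, ha.trans (relativeTrace_bot a)⟩
  · rintro ⟨a, ha⟩
    refine ⟨⊥, ⟨⟨a, ?_, ha.trans (relativeTrace_bot a).symm⟩, fun D' hD' => ?_⟩, by simp⟩
    · intro d hd
      rw [Subgroup.mem_bot.1 hd, conj, inv_one, map_one, one_mul, mul_one]
    · exact absurd hD' not_lt_bot

/-- A central idempotent that is a relative trace from the trivial subgroup annihilates the
Jacobson radical. -/
theorem jacobson_mul_eq_zero_of_trace [Fintype H] {f a : MonoidAlgebra F H}
    (hf : IsCentralIdempotent f) (ha : f = ∑ g : H, conj F g a) {j : MonoidAlgebra F H}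
    (hj : j ∈ Ring.jacobson (MonoidAlgebra F H)) : j * f = 0 := by
  let U : Ideal (MonoidAlgebra F H) := Ring.jacobson (MonoidAlgebra F H) ⊓ Ideal.span {f}
  obtain ⟨π, hπ⟩ := (U.restrictScalars F).subtype.exists_leftInverse_of_injective
    (Submodule.ker_subtype _)
  have hπU : ∀ x ∈ U, ((π x : U.restrictScalars F) : MonoidAlgebra F H) = x := fun x hx =>
    congrArg Subtype.val (LinearMap.congr_fun hπ ⟨x, hx⟩)
  -- Higman's averaging: `x ↦ x v` is the `a`-weighted average of the linear projection `π` onto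
  -- `U`. It fixes `U`, because the trace of `a` is `f`. So `v` is an idempotent in the radical,
  -- hence zero, and `U = 0`.
  set v : MonoidAlgebra F H := ∑ g : H, MonoidAlgebra.of F H g * a *
    (π (MonoidAlgebra.of F H g⁻¹) : MonoidAlgebra F H) with hv
  have hvU : v ∈ U := U.sum_mem fun g _ => U.mul_mem_left _ (π _).2
  have hlin : ∀ x : MonoidAlgebra F H, x * v = ∑ g : H, MonoidAlgebra.of F H g * a *
      (π (MonoidAlgebra.of F H g⁻¹ * x) : MonoidAlgebra F H) := by
    intro x
    induction x using MonoidAlgebra.induction_linear with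
    | zero => simp
    | add x y hx hy =>
      rw [add_mul, hx, hy, ← Finset.sum_add_distrib]
      simp only [mul_add, map_add, Submodule.coe_add]
    | single h r =>
      have hs : (MonoidAlgebra.single h r : MonoidAlgebra F H) = r • MonoidAlgebra.of F H h := by
        simp
      rw [hs, hv, Finset.mul_sum]
      refine Fintype.sum_equiv (Equiv.mulLeft h) _ _ fun g => ?_
      rw [mul_smul_comm, map_smul, Submodule.coe_smul, mul_smul_comm, smul_mul_assoc]
      simp only [Equiv.coe_mulLeft, mul_inv_rev, map_mul, ← mul_assoc]
      rw [mul_assoc _ (MonoidAlgebra.of F H h⁻¹), ← map_mul (MonoidAlgebra.of F H) h⁻¹ h,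
        inv_mul_cancel, map_one, mul_one]
  have hfix : ∀ x ∈ U, x * v = x := by
    intro x hx
    have hxf : f * x = x := by rw [hf.1]; exact hf.mem_span_iff.1 hx.2
    have hsum : ∑ g : H, conj F g a * x = x := by rw [← Finset.sum_mul, ← ha, hxf]
    refine (hlin x).trans (Eq.trans ?_ hsum)
    refine Finset.sum_congr rfl fun g _ => ?_
    rw [hπU _ (U.mul_mem_left _ hx), conj, mul_assoc _ (MonoidAlgebra.of F H g⁻¹)]
  have hv0 : v = 0 := eq_zero_of_mem_jacobson_of_mul_self hvU.1 (hfix v hvU)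
  have hjU : j * f ∈ U := ⟨Ideal.mul_mem_right f _ hj,
    Ideal.mul_mem_left _ j (Ideal.mem_span_singleton_self f)⟩
  rw [← hfix _ hjU, hv0, mul_zero]

theorem exists_smul_of_isSplittingFieldFor {A : Type*} [Ring A] [Algebra F A]
    (hA : IsSplittingFieldFor F A) {T : Type*} [AddCommGroup T] [Module A T] [IsSimpleModule A T]
    (φ : Module.End A T) : ∃ c : F, ∀ x, φ x = algebraMap F A c • x := by
  obtain ⟨m, hm, ⟨ψ⟩⟩ := isSimpleModule_iff_quot_maximal.1 ‹IsSimpleModule A T›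
  obtain ⟨c, hc⟩ := hA m hm.1 (ψ.toLinearMap ∘ₗ φ ∘ₗ ψ.symm.toLinearMap)
  refine ⟨c, fun x => ψ.injective ?_⟩
  rw [map_smul, algebraMap_smul, ← hc]
  simp

theorem conj_sum_mul_comm [Fintype H] (a x : MonoidAlgebra F H) :
    (∑ g : H, conj F g a) * x = x * ∑ g : H, conj F g a := by
  induction x using MonoidAlgebra.induction_linear with
  | zero => simp
  | add x y hx hy => rw [mul_add, add_mul, hx, hy]
  | single h r =>
    have hs : (MonoidAlgebra.single h r : MonoidAlgebra F H) = r • MonoidAlgebra.of F H h := by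
      simp
    rw [hs, mul_smul_comm, smul_mul_assoc, Finset.sum_mul, Finset.mul_sum]
    congr 1
    refine (Fintype.sum_equiv (Equiv.mulLeft h) _ _ fun g => ?_).symm
    simp only [conj, Equiv.coe_mulLeft, mul_inv_rev, map_mul, mul_assoc]
    rw [← map_mul (MonoidAlgebra.of F H) h⁻¹ h, inv_mul_cancel, map_one, mul_one]

/-- The diagonal entry at `h` is the coefficient of `h` in `a h b`, that is, of `1` in `h⁻¹ a h b`.
-/
theorem trace_mulLeft_mulRight [Fintype H] (a b : MonoidAlgebra F H) :
    LinearMap.trace F _ (LinearMap.mulLeft F a ∘ₗ LinearMap.mulRight F b) =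
      ((∑ g : H, conj F g a) * b).coeff 1 := by
  classical
  rw [LinearMap.trace_eq_matrix_trace F (MonoidAlgebra.basis H F), Matrix.trace, Finset.sum_mul,
    MonoidAlgebra.coeff_sum, Finsupp.finsetSum_apply]
  refine Fintype.sum_equiv (Equiv.inv H) _ _ fun h => ?_
  rw [Matrix.diag_apply, LinearMap.toMatrix_apply, MonoidAlgebra.basis_apply]
  change (a * (MonoidAlgebra.single h 1 * b)).coeff h = _
  rw [conj, Equiv.inv_apply, inv_inv, MonoidAlgebra.of_apply, MonoidAlgebra.of_apply, mul_assoc,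
    mul_assoc, MonoidAlgebra.coeff_single_mul_eq_mul_coeff h (fun m _ => by
      rw [inv_mul_eq_one, eq_comm]), one_mul]

/-- A block idempotent that annihilates the Jacobson radical is a relative trace from the trivial
subgroup. -/
theorem exists_trace_of_jacobson_mul_eq_zero [Fintype H]
    (hH : IsSplittingFieldFor F (MonoidAlgebra F H)) {f : MonoidAlgebra F H}
    (hf : IsBlockIdempotent f)
    (hJ : ∀ j ∈ Ring.jacobson (MonoidAlgebra F H), j * f = 0) :
    ∃ a : MonoidAlgebra F H, f = ∑ g : H, conj F g a := by
  have := isArtinianRing_monoidAlgebra F H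
  obtain ⟨P, hP, hPf, -⟩ := exists_isPIM_le (fun P => P ≠ ⊥) (by simp)
    (fun U V h => by
      by_contra! h'
      exact h (by rw [h'.1, h'.2, bot_sup_eq])) hf.1.exists_isCompl
    (by simpa [Ideal.span_singleton_eq_bot] using hf.2.1)
  -- The radical of `P` lies in the Jacobson radical and in the block, so `f` both kills and fixes
  -- it. Hence `P` is simple.
  have hrad : Module.jacobson (MonoidAlgebra F H) P = ⊥ := by
    rw [eq_bot_iff]
    intro x hx
    have h1 : (x : MonoidAlgebra F H) ∈ Ring.jacobson (MonoidAlgebra F H) :=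
      Module.le_comap_jacobson P.subtype hx
    have h2 := hf.1.mem_span_iff.1 (hPf x.2)
    rw [hJ _ h1] at h2
    exact Subtype.ext h2.symm
  have := hP.isSimpleModule_head
  have : IsSimpleModule (MonoidAlgebra F H) P :=
    IsSimpleModule.congr ((Submodule.quotEquivOfEqBot _ hrad).symm)
  obtain ⟨ε, hε, h⟩ := (exists_isCompl_iff_exists_right_identity P).1 hP.1
  have hεε := h ε hε
  have hε0 : ε ≠ 0 := by
    rintro rfl
    refine hP.2.1 (eq_bot_iff.2 fun x hx => ?_)
    rw [← h x hx, mul_zero]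
    exact Submodule.zero_mem _
  have hεf : ε * f = ε := hf.1.mem_span_iff.1 (hPf hε)
  -- Right multiplication by `a * ε` is an endomorphism of the simple module `P`, hence a scalar.
  have hcorner : ∀ a, ∃ c : F, ε * (a * ε) = c • ε := by
    intro a
    obtain ⟨c, hc⟩ := exists_smul_of_isSplittingFieldFor hH
      (LinearMap.toSpanSingleton _ P ⟨a * ε, P.smul_mem a hε⟩ ∘ₗ P.subtype)
    refine ⟨c, ?_⟩
    rw [Algebra.smul_def]
    exact congrArg Subtype.val (hc ⟨ε, hε⟩)
  have hcentral : ∀ z, (∀ x, z * x = x * z) → ∃ c : F, z * ε = c • ε := by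
    intro z hz
    obtain ⟨c, hc⟩ := hcorner z
    refine ⟨c, ?_⟩
    rw [← hc, ← mul_assoc, ← hz ε, mul_assoc, hεε]
  set t := ∑ g : H, conj F g ε with ht
  have ht_comm : ∀ x, t * x = x * t := conj_sum_mul_comm ε
  -- `x ↦ ε x ε` projects onto the line `F ε`, so its trace is `1`. By the trace formula this is the
  -- coefficient of `1` in `t ε`.
  have htε : t * ε ≠ 0 := by
    intro h0
    have htr := trace_mulLeft_mulRight (F := F) ε ε
    have hproj : LinearMap.IsProj (F ∙ ε) (LinearMap.mulLeft F ε ∘ₗ LinearMap.mulRight F ε) := by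
      constructor
      · intro x
        obtain ⟨c, hc⟩ := hcorner x
        exact Submodule.mem_span_singleton.2 ⟨c, hc.symm⟩
      · intro x hx
        obtain ⟨c, rfl⟩ := Submodule.mem_span_singleton.1 hx
        simp [hεε]
    rw [hproj.trace, finrank_span_singleton hε0, ← ht, h0] at htr
    simp at htr
  have htf : t * f = t := by
    rw [ht, Finset.sum_mul]
    refine Finset.sum_congr rfl fun g _ => ?_
    rw [conj, mul_assoc, ← hf.1.1, ← mul_assoc, mul_assoc _ ε f, hεf]
  obtain ⟨c, hc⟩ := hcentral t ht_comm
  have hc0 : c ≠ 0 := by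
    rintro rfl
    exact htε (by rw [hc, zero_smul])
  -- It remains to show `z = 0`, that is, `t = c f`.
  set z := t - c • f with hz
  have hz_comm : ∀ x, z * x = x * z := fun x => by
    rw [hz, sub_mul, mul_sub, ht_comm, smul_mul_assoc, mul_smul_comm, hf.1.1]
  have hzf : z * f = z := by rw [hz, sub_mul, htf, smul_mul_assoc, hf.1.2]
  have hzε : z * ε = 0 := by
    rw [hz, sub_mul, hc, smul_mul_assoc, hf.1.1, hεf, sub_self]
  have htwo : (Ideal.span {z}).IsTwoSided := ⟨fun {a} b ha => by
    obtain ⟨d, rfl⟩ := Ideal.mem_span_singleton'.1 ha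
    rw [mul_assoc, hz_comm, ← mul_assoc]
    exact Ideal.mul_mem_left _ _ (Ideal.mem_span_singleton_self z)⟩
  have hjz : ∀ j ∈ Ring.jacobson (MonoidAlgebra F H), j * z = 0 := fun j hj => by
    rw [← hzf, hz_comm, ← mul_assoc, hJ j hj, zero_mul]
  obtain ⟨w, hwK, hw, hwid⟩ := exists_isCentralIdempotent_of_mul_jacobson (Ideal.span {z})
    (fun j hj x hx => by
      obtain ⟨d, rfl⟩ := Ideal.mem_span_singleton'.1 hx
      rw [← mul_assoc]
      exact hjz _ (Ideal.mul_mem_right d _ hj))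
    (fun j hj x hx => by
      obtain ⟨d, rfl⟩ := Ideal.mem_span_singleton'.1 hx
      rw [mul_assoc, hz_comm, hjz j hj, mul_zero])
  obtain ⟨d, hd⟩ := Ideal.mem_span_singleton'.1 hwK
  -- By primitivity `w` is `0` or `f`, and `w = f` would put `ε = f ε` in `A z ε = 0`, where `A` is
  -- the group algebra.
  have hw0 : w = 0 := by
    refine (hf.2.2 w hw (by rw [← hd, mul_assoc, hzf])).resolve_right fun hwf => hε0 ?_
    rw [← hεf, ← hf.1.1, ← hwf, ← hd, mul_assoc, hzε, mul_zero]
  have hzz : z * z = 0 := by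
    have hzK := Ideal.mem_span_singleton_self z
    rw [← hwid z hzK z hzK, hw0, mul_zero]
  have hz0 : z = 0 := by
    rw [← hzf]
    refine hJ z (mem_jacobson_of_mul_mul_eq_zero fun y => ?_)
    rw [mul_assoc, ← hz_comm, ← mul_assoc, hzz, zero_mul]
  refine ⟨c⁻¹ • ε, ?_⟩
  have hconj : ∀ g : H, conj F g (c⁻¹ • ε) = c⁻¹ • conj F g ε := fun g => by
    rw [conj, conj, mul_smul_comm, smul_mul_assoc]
  simp only [hconj]
  rw [← Finset.smul_sum, ← ht, sub_eq_zero.1 hz0, smul_smul, inv_mul_cancel₀ hc0, one_smul]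

end GroupAlgebra

/-! ### Passage between `FN` and `FG`. -/

section Covering

variable {F : Type*} [Field F] {G : Type*} [Group G] {N : Subgroup G} [N.Normal]

/-- Conjugation by `g` on the group algebra of a normal subgroup. -/
noncomputable def conjNormalEquiv (F : Type*) [Field F] {G : Type*} [Group G] (N : Subgroup G)
    [N.Normal] (g : G) : MonoidAlgebra F N ≃+* MonoidAlgebra F N :=
  MonoidAlgebra.mapDomainRingEquiv F (MulAut.conjNormal g)

theorem of_mul_incl (g : G) (a : MonoidAlgebra F N) :
    MonoidAlgebra.of F G g * incl F N a =
      incl F N (conjNormalEquiv F N g a) * MonoidAlgebra.of F G g := by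
  induction a using MonoidAlgebra.induction_linear with
  | zero => simp
  | add a b ha hb => simp only [map_add, add_mul, mul_add, ha, hb]
  | single n r => simp [conjNormalEquiv, MonoidAlgebra.single_mul_single, mul_assoc]

theorem map_mem_jacobson_of_ringEquiv {A : Type*} [Ring A] (φ : A ≃+* A) {j : A}
    (hj : j ∈ Ring.jacobson A) : φ j ∈ Ring.jacobson A := by
  have : RingHomSurjective (φ : A →+* A) := ⟨φ.surjective⟩
  exact Ring.le_comap_jacobson (φ : A →+* A) hj

/-- Every element of `FG` is a combination of coset representatives with coefficients in `FN`. -/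
theorem exists_eq_sum_incl_mul_of [Fintype (G ⧸ N)] (x : MonoidAlgebra F G) :
    ∃ c : G ⧸ N → MonoidAlgebra F N,
      x = ∑ q, incl F N (c q) * MonoidAlgebra.of F G (Quotient.out q) := by
  classical
  induction x using MonoidAlgebra.induction_linear with
  | zero => exact ⟨0, by simp⟩
  | add x y hx hy =>
    obtain ⟨c, rfl⟩ := hx
    obtain ⟨d, rfl⟩ := hy
    exact ⟨c + d, by
      simp only [Pi.add_apply, map_add, add_mul, Finset.sum_add_distrib]⟩
  | single g r =>
    let q₀ : G ⧸ N := QuotientGroup.mk g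
    have hn : g * (Quotient.out q₀)⁻¹ ∈ N := by
      have h := QuotientGroup.out_eq' q₀
      rw [QuotientGroup.eq] at h
      exact Subgroup.Normal.mem_comm inferInstance h
    refine ⟨Pi.single q₀ (MonoidAlgebra.single ⟨_, hn⟩ r), ?_⟩
    rw [Finset.sum_eq_single q₀ (fun q _ hq => by simp [hq]) (by simp)]
    simp [MonoidAlgebra.single_mul_single]

/-- The summands are supported on different cosets, left and right cosets being the same for normal
`N`. -/
theorem eq_zero_of_sum_incl_mul_of [Fintype (G ⧸ N)] {c : G ⧸ N → MonoidAlgebra F N}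
    (h : ∑ q, incl F N (c q) * MonoidAlgebra.of F G (Quotient.out q) = 0) (q : G ⧸ N) :
    c q = 0 := by
  ext n
  have h1 := congrArg (fun x => x.coeff ((n : G) * Quotient.out q)) h
  simp only [MonoidAlgebra.coeff_sum, Finsupp.finsetSum_apply] at h1
  have hcoeff : ∀ (x : MonoidAlgebra F G) (s t : G),
      (x * MonoidAlgebra.of F G s).coeff t = x.coeff (t * s⁻¹) := fun x s t => by
    rw [MonoidAlgebra.of_apply, MonoidAlgebra.coeff_mul_single_eq_coeff_mul (t * s⁻¹)
      (fun m _ => by rw [eq_mul_inv_iff_mul_eq]), mul_one]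
  simp only [hcoeff] at h1
  rw [Finset.sum_eq_single q ?_ (by simp)] at h1
  · rw [mul_inv_cancel_right] at h1
    rw [← show (incl F N (c q)).coeff (n : G) = (c q).coeff n from
      Finsupp.mapDomain_apply N.subtype_injective _ n, h1]
    rfl
  · intro q' _ hq'
    refine Finsupp.mapDomain_of_notMem_range _ _ ?_
    rintro ⟨m, hm⟩
    apply hq'
    have hm' : (m : G) = n * Quotient.out q * (Quotient.out q')⁻¹ := hm
    have h2 : (Quotient.out q : G) * (Quotient.out q')⁻¹ ∈ N := by
      have h3 := N.mul_mem (N.inv_mem n.2) m.2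
      rwa [hm', mul_assoc, inv_mul_cancel_left] at h3
    have h4 := Subgroup.Normal.mem_comm inferInstance h2
    rw [← QuotientGroup.out_eq' q', ← QuotientGroup.out_eq' q]
    exact QuotientGroup.eq.2 h4

/-- The two-sided annihilator of the Jacobson radical. -/
def radicalAnnihilator (A : Type*) [Ring A] : Ideal A where
  carrier := {x | ∀ j ∈ Ring.jacobson A, j * x = 0 ∧ x * j = 0}
  add_mem' := fun ha hb j hj => by
    rw [mul_add, add_mul, (ha j hj).1, (hb j hj).1, (ha j hj).2, (hb j hj).2]
    simp
  zero_mem' := fun j _ => by simp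
  smul_mem' := fun c x hx j hj => by
    rw [smul_eq_mul, ← mul_assoc, mul_assoc c, (hx j hj).2,
      (hx _ (Ideal.mul_mem_right c _ hj)).1, mul_zero]
    simp

instance radicalAnnihilator_isTwoSided (A : Type*) [Ring A] :
    (radicalAnnihilator A).IsTwoSided :=
  ⟨fun {a} b ha j hj => ⟨by rw [← mul_assoc, (ha j hj).1, zero_mul],
    by rw [mul_assoc, (ha _ (Ideal.mul_mem_left _ b hj)).2]⟩⟩

theorem map_mem_radicalAnnihilator {A : Type*} [Ring A] (φ : A ≃+* A) {x : A}
    (hx : x ∈ radicalAnnihilator A) : φ x ∈ radicalAnnihilator A := by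
  intro j hj
  have h := hx _ (map_mem_jacobson_of_ringEquiv φ.symm hj)
  constructor
  · rw [← φ.apply_symm_apply j, ← map_mul, h.1, map_zero]
  · rw [← φ.apply_symm_apply j, ← map_mul, h.2, map_zero]

/-- `w` is a central idempotent that annihilates the Jacobson radical and is an
identity on the products of elements with that property. -/
structure IsRadicalAnnihilatorIdempotent {A : Type*} [Ring A] (w : A) : Prop where
  isCentralIdempotent : IsCentralIdempotent w
  mem : w ∈ radicalAnnihilator A
  mul_eq : ∀ x ∈ radicalAnnihilator A, ∀ y ∈ radicalAnnihilator A, x * y * w = x * y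

theorem exists_isRadicalAnnihilatorIdempotent (A : Type*) [Ring A] [IsArtinianRing A] :
    ∃ w : A, IsRadicalAnnihilatorIdempotent w := by
  obtain ⟨w, hw, hwc, h⟩ := exists_isCentralIdempotent_of_mul_jacobson (radicalAnnihilator A)
    (fun j hj x hx => (hx j hj).1) (fun j hj x hx => (hx j hj).2)
  exact ⟨w, hwc, hw, h⟩

/-- `w` is an identity for `φ w`, and, by the same argument for `φ⁻¹`, `φ w` is one for `w`. -/
theorem IsRadicalAnnihilatorIdempotent.map_eq {A : Type*} [Ring A] {w : A}
    (hw : IsRadicalAnnihilatorIdempotent w) (φ : A ≃+* A) : φ w = w := by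
  have h1 := map_mem_radicalAnnihilator φ hw.mem
  have h2 := hw.mul_eq _ h1 _ h1
  rw [← map_mul, hw.isCentralIdempotent.2] at h2
  have h3 := map_mem_radicalAnnihilator φ.symm hw.mem
  have h4 := hw.mul_eq _ h3 _ h3
  rw [← map_mul, hw.isCentralIdempotent.2] at h4
  have h5 := congrArg φ h4
  rw [map_mul, φ.apply_symm_apply] at h5
  rw [← h2, ← hw.isCentralIdempotent.1, h5]

theorem IsRadicalAnnihilatorIdempotent.incl_isCentralIdempotent {w : MonoidAlgebra F N}
    (hw : IsRadicalAnnihilatorIdempotent w) : IsCentralIdempotent (incl F N w) := by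
  refine ⟨fun x => ?_, by rw [← map_mul, hw.isCentralIdempotent.2]⟩
  induction x using MonoidAlgebra.induction_linear with
  | zero => simp
  | add x y hx hy => rw [mul_add, add_mul, hx, hy]
  | single g r =>
    have hs : (MonoidAlgebra.single g r : MonoidAlgebra F G) = r • MonoidAlgebra.of F G g := by
      simp
    rw [hs, mul_smul_comm, smul_mul_assoc, of_mul_incl, hw.map_eq]

theorem toQuotientGroup_incl_eq_zero {j : MonoidAlgebra F N}
    (hj : j ∈ Ring.jacobson (MonoidAlgebra F N)) :
    toQuotientGroup F N (incl F N j) = 0 := by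
  let aug : MonoidAlgebra F N →+* F := (MonoidAlgebra.lift F F N 1).toRingHom
  have hs : Function.Surjective aug := fun r => ⟨MonoidAlgebra.single 1 r, by simp [aug]⟩
  have : RingHomSurjective aug := ⟨hs⟩
  -- On `FN` the map is the augmentation, which sends the radical into the radical of the field `F`.
  have h1 : aug j = 0 := by
    have h2 : aug j ∈ Ring.jacobson F := Ring.le_comap_jacobson aug hj
    exact (Submodule.mem_bot F).1 ((IsSemisimpleModule.jacobson_eq_bot F F).le h2)
  have h2 : ∀ x : MonoidAlgebra F N,
      toQuotientGroup F N (incl F N x) = MonoidAlgebra.single 1 (aug x) := by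
    intro x
    induction x using MonoidAlgebra.induction_linear with
    | zero => simp
    | add x y hx hy => simp only [map_add, hx, hy, MonoidAlgebra.single_add]
    | single n r =>
      simp [aug, (QuotientGroup.eq_one_iff (n : G)).2 n.2]
  rw [h2, h1, MonoidAlgebra.single_zero]

theorem toQuotientGroup_surjective : Function.Surjective (toQuotientGroup F N) := by
  intro y
  induction y using MonoidAlgebra.induction_linear with
  | zero => exact ⟨0, map_zero _⟩
  | add x y hx hy =>
    obtain ⟨a, rfl⟩ := hx
    obtain ⟨b, rfl⟩ := hy
    exact ⟨a + b, map_add _ a b⟩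
  | single q r =>
    obtain ⟨g, rfl⟩ := QuotientGroup.mk'_surjective N q
    exact ⟨MonoidAlgebra.single g r, by simp⟩

variable [Finite G]

/-- A block of `FG` that covers a block of `FN` that annihilates the Jacobson radical of `FN`
annihilates that radical. -/
theorem incl_mul_eq_zero_of_covers {e : MonoidAlgebra F G} (he : IsBlockIdempotent e)
    {f : MonoidAlgebra F N} (hf : IsCentralIdempotent f)
    (hJ : ∀ j ∈ Ring.jacobson (MonoidAlgebra F N), j * f = 0) (hc : Covers F N e f)
    {j : MonoidAlgebra F N} (hj : j ∈ Ring.jacobson (MonoidAlgebra F N)) :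
    incl F N j * e = 0 := by
  have := isArtinianRing_monoidAlgebra F N
  obtain ⟨w, hw⟩ := exists_isRadicalAnnihilatorIdempotent (MonoidAlgebra F N)
  have hfK : f ∈ radicalAnnihilator (MonoidAlgebra F N) :=
    fun j hj => ⟨hJ j hj, by rw [hf.1, hJ j hj]⟩
  have hfw : f * w = f := by
    have := hw.mul_eq f hfK f hfK
    rwa [hf.2] at this
  have hwG := hw.incl_isCentralIdempotent
  -- `w e` is a central idempotent below `e`. It is not zero, because `f = f w` and `e f ≠ 0`.
  have hew : incl F N w * e = e := by
    refine (he.2.2 (incl F N w * e) ⟨fun x => ?_, ?_⟩ ?_).resolve_left fun h0 => hc ?_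
    · rw [mul_assoc, he.1.1, ← mul_assoc, hwG.1, mul_assoc]
    · rw [mul_assoc, ← mul_assoc e, he.1.1 (incl F N w), mul_assoc, he.1.2, ← mul_assoc, hwG.2]
    · rw [mul_assoc, he.1.2]
    · rw [← hfw, hf.1, map_mul, ← mul_assoc, he.1.1, h0, zero_mul]
  rw [← hew, ← mul_assoc, ← map_mul, (hw.mem j hj).1, map_zero, zero_mul]

/-- If the block idempotent `e` of `FG` annihilates the Jacobson radical of `FN`, then it covers a
block of `FN` that annihilates that radical. -/
theorem exists_covers_of_incl_mul_eq_zero {e : MonoidAlgebra F G} (he : IsCentralIdempotent e)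
    (he0 : e ≠ 0)
    (hJ : ∀ j ∈ Ring.jacobson (MonoidAlgebra F N), incl F N j * e = 0) :
    ∃ f : MonoidAlgebra F N, IsBlockIdempotent f ∧ Covers F N e f ∧
      ∀ j ∈ Ring.jacobson (MonoidAlgebra F N), j * f = 0 := by
  have := Fintype.ofFinite (G ⧸ N)
  have := isArtinianRing_monoidAlgebra F N
  obtain ⟨w, hw⟩ := exists_isRadicalAnnihilatorIdempotent (MonoidAlgebra F N)
  obtain ⟨f, hf, hef⟩ := exists_isBlockIdempotent (fun f => e * incl F N f ≠ 0) (by simp)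
    (by rw [map_one, mul_one]; exact he0) (fun f g h => by
      by_contra! h'
      exact h (by rw [map_add, mul_add, h'.1, h'.2, add_zero]))
  obtain ⟨c, hc⟩ := exists_eq_sum_incl_mul_of (N := N) e
  have hcK : ∀ q, c q ∈ radicalAnnihilator (MonoidAlgebra F N) := by
    intro q j hj
    constructor
    · refine eq_zero_of_sum_incl_mul_of (c := fun q => j * c q) ?_ q
      have h := hJ j hj
      rw [hc, Finset.mul_sum] at h
      simpa only [map_mul, mul_assoc] using h
    -- Moving an element of `FN` past the representative of `q` conjugates it. The conjugation is
    -- undone in advance so that the coefficient at `q` is `c q * j`.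
    · have h := hJ _ (map_mem_jacobson_of_ringEquiv (conjNormalEquiv F N (Quotient.out q)).symm hj)
      rw [← he.1, hc, Finset.sum_mul] at h
      have h2 := eq_zero_of_sum_incl_mul_of (c := fun q' => c q' *
        conjNormalEquiv F N (Quotient.out q')
          ((conjNormalEquiv F N (Quotient.out q)).symm j)) (by
        simpa only [map_mul, mul_assoc, of_mul_incl] using h) q
      simpa using h2
  -- `w` is an identity only on products of annihilators, so `e = e * e` is used to write `e` with
  -- coefficients `c q * c q'`.
  have hew : e * incl F N w = e := by
    have hee : e = ∑ q, ∑ q', incl F N (c q * c q') *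
        (MonoidAlgebra.of F G (Quotient.out q') * MonoidAlgebra.of F G (Quotient.out q)) := by
      calc e = e * e := he.2.symm
        _ = ∑ q, incl F N (c q) * MonoidAlgebra.of F G (Quotient.out q) * e := by
          rw [← Finset.sum_mul, ← hc]
        _ = _ := Finset.sum_congr rfl fun q _ => by
          rw [mul_assoc, ← he.1]
          conv_lhs => rw [hc]
          rw [Finset.sum_mul, Finset.mul_sum]
          exact Finset.sum_congr rfl fun q' _ => by simp only [map_mul, mul_assoc]
    rw [he.1]
    conv_lhs => rw [hee]
    rw [Finset.mul_sum]
    conv_rhs => rw [hee]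
    refine Finset.sum_congr rfl fun q _ => ?_
    rw [Finset.mul_sum]
    refine Finset.sum_congr rfl fun q' _ => ?_
    rw [← mul_assoc, ← map_mul, hw.isCentralIdempotent.1, hw.mul_eq _ (hcK q) _ (hcK q')]
  have hfw : f * w = f := by
    have hcomm := hw.isCentralIdempotent
    refine (hf.2.2 (f * w) ⟨fun x => ?_, ?_⟩ ?_).resolve_left fun h0 => hef ?_
    · rw [mul_assoc, hcomm.1, ← mul_assoc, hf.1.1, mul_assoc]
    · rw [mul_assoc, ← mul_assoc w, hcomm.1 f, mul_assoc, hcomm.2, ← mul_assoc, hf.1.2]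
    · rw [mul_assoc, hcomm.1, ← mul_assoc, hf.1.2]
    · rw [← hew, mul_assoc, ← map_mul, hcomm.1, h0, map_zero, mul_zero]
  refine ⟨f, hf, hef, fun j hj => ?_⟩
  rw [← hfw, hf.1.1, ← mul_assoc, (hw.mem j hj).1, zero_mul]

end Covering

end BlockCartan

/-! ### Assembly of the two equivalences. -/

theorem corollary5p4 {p : ℕ} [Fact p.Prime] {F : Type*} [Field F] [CharP F p]
    {G : Type*} [Group G] [Finite G] (N : Subgroup G) [N.Normal]
    (hG : BlockCartan.IsSplittingFieldFor F (MonoidAlgebra F G))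
    (hN : BlockCartan.IsSplittingFieldFor F (MonoidAlgebra F N))
    (e : MonoidAlgebra F G) (he : BlockCartan.IsBlockIdempotent e)
    (B : Ideal (MonoidAlgebra F G)) (hB : B = Ideal.span {e}) :
    ((∃ f : MonoidAlgebra F N, BlockCartan.IsBlockIdempotent f ∧
        BlockCartan.HasDefect F p f 0 ∧ BlockCartan.Covers F N e f) ↔
      BlockCartan.SameCartanMatrix B (B.map (BlockCartan.toQuotientGroup F N)) ∨
      BlockCartan.SameCartanMatrix B (B.map (BlockCartan.toRadicalQuotient F N))) ∧
    ((∃ f : MonoidAlgebra F N, BlockCartan.IsBlockIdempotent f ∧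
        BlockCartan.HasDefect F p f 0 ∧ BlockCartan.Covers F N e f) ↔
      BlockCartan.SameCartanMatrixAlong (BlockCartan.toQuotientGroup F N) B ∨
      BlockCartan.SameCartanMatrixAlong (BlockCartan.toRadicalQuotient F N) B) := by
  subst hB
  have := Fintype.ofFinite N
  have := BlockCartan.isArtinianRing_monoidAlgebra F G
  have := BlockCartan.isArtinianRing_monoidAlgebra F (G ⧸ N)
  have hs₂ : Function.Surjective (BlockCartan.toRadicalQuotient F N) :=
    Ideal.Quotient.mk_surjective
  have : RingHomSurjective (BlockCartan.toRadicalQuotient F N) := ⟨hs₂⟩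
  have : RingHomSurjective (BlockCartan.toQuotientGroup F N) :=
    ⟨BlockCartan.toQuotientGroup_surjective⟩
  have along_of_covers : (∃ f : MonoidAlgebra F N, BlockCartan.IsBlockIdempotent f ∧
      BlockCartan.HasDefect F p f 0 ∧ BlockCartan.Covers F N e f) →
      BlockCartan.SameCartanMatrixAlong (BlockCartan.toRadicalQuotient F N)
        (Ideal.span {e}) := by
    rintro ⟨f, hf, hd, hc⟩
    obtain ⟨a, ha⟩ := (BlockCartan.hasDefect_zero_iff p f).1 hd
    have hJ := fun j hj => BlockCartan.incl_mul_eq_zero_of_covers he hf.1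
      (fun j hj => BlockCartan.jacobson_mul_eq_zero_of_trace hf.1 ha hj) hc (j := j) hj
    refine BlockCartan.sameCartanMatrixAlong_of_injOn hs₂ fun x hx hx0 => ?_
    rw [← he.1.mem_span_iff.1 hx]
    -- The left annihilator of `e` is a left ideal containing `J(FN)`, hence all of `FG J(FN)`, so
    -- `x e = 0`.
    have hle : BlockCartan.radicalIdeal F N ≤
        LinearMap.ker (LinearMap.toSpanSingleton _ (MonoidAlgebra F G) e) := by
      refine Ideal.map_le_iff_le_comap.2 fun j hj => ?_
      exact hJ j hj
    exact hle (Ideal.Quotient.eq_zero_iff_mem.1 hx0)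
  have covers_of_annihilates : (∀ j ∈ Ring.jacobson (MonoidAlgebra F N),
      BlockCartan.incl F N j * e = 0) → ∃ f : MonoidAlgebra F N,
      BlockCartan.IsBlockIdempotent f ∧ BlockCartan.HasDefect F p f 0 ∧
        BlockCartan.Covers F N e f := by
    intro hJ
    obtain ⟨f, hf, hc, hfJ⟩ := BlockCartan.exists_covers_of_incl_mul_eq_zero he.1 he.2.1 hJ
    exact ⟨f, hf, (BlockCartan.hasDefect_zero_iff p f).2
      (BlockCartan.exists_trace_of_jacobson_mul_eq_zero hN hf hfJ), hc⟩
  have covers_of_same₁ : BlockCartan.SameCartanMatrix (Ideal.span {e})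
      ((Ideal.span {e}).map (BlockCartan.toQuotientGroup F N)) → _ := fun h =>
    covers_of_annihilates fun j hj => h.mul_eq_zero he.1
      (BlockCartan.toQuotientGroup_incl_eq_zero hj)
  have covers_of_same₂ : BlockCartan.SameCartanMatrix (Ideal.span {e})
      ((Ideal.span {e}).map (BlockCartan.toRadicalQuotient F N)) → _ := fun h =>
    covers_of_annihilates fun j hj => h.mul_eq_zero he.1
      (Ideal.Quotient.eq_zero_iff_mem.2 (Ideal.mem_map_of_mem _ hj))
  -- Covering yields the stronger, indexed equality for the radical quotient, and the weaker
  -- equality for either quotient yields covering. This settles both readings.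
  exact ⟨⟨fun h => Or.inr (along_of_covers h).sameCartanMatrix,
    fun h => h.elim covers_of_same₁ covers_of_same₂⟩,
    ⟨fun h => Or.inr (along_of_covers h), fun h => h.elim
      (fun h => covers_of_same₁ h.sameCartanMatrix)
      (fun h => covers_of_same₂ h.sameCartanMatrix)⟩⟩
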